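/- Let $\Bbbk$ be an algebraically closed field of characteristic zero and let $n\ge 1$. Let $A=Q_n$ be the quotient of the path algebra over $\Bbbk$ of the cyclic quiver with vertex set $\mathbb{Z}_n=\mathbb{Z}/n\mathbb{Z}$ and arrows $\alpha_i\colon i\to i+1$ ($i\in\mathbb{Z}_n$) by the relations that all paths of length two are zero; for $n=1$ this is the algebra $\Bbbk[x]/(x^2)$ of dual numbers. Paths are composed from right to left, and $\varepsilon_i$ denotes the idempotent at the vertex $i$, so that $\alpha_i=\varepsilon_{i+1}\alpha_i\varepsilon_i$. For a positive integer $m$ and a non-zero $\lambda\in\Bbbk$, let $B(1,m,\lambda)$ be the following $A$-$A$-bimodule. Its underlying space is $\bigoplus_{i\in\mathbb{Z}_n}(T_i\oplus S_i)$ with $T_i=S_i=\Bbbk^m$. The left action of $\varepsilon_i$ is the projection onto $T_i\oplus S_{i-1}$, and the right action of $\varepsilon_i$ is the projection onto $T_i\oplus S_i$. The left action of $\alpha_i$ maps $T_i$ to $S_i$ by the identity, and the right action of $\alpha_i$ maps $T_{i+1}$ to $S_i$ by the identity if $i\neq 1$ in $\mathbb{Z}_n$, and by the Jordan cell $J_m(\lambda)$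 if $i=1$ in $\mathbb{Z}_n$; both are zero on all other summands. For $k\in\mathbb{Z}_n$, let $B(k,m,\lambda)=B(1,m,\lambda)^{\theta^{k-1}}$ be the bimodule obtained from $B(1,m,\lambda)$ by twisting the right action by $\theta^{k-1}$ (so that $a$ acts on the right as $\theta^{k-1}(a)$), where $\theta$ is the automorphism of $A$ with $\theta(\varepsilon_i)=\varepsilon_{i+1}$ and $\theta(\alpha_i)=\alpha_{i+1}$. In particular, $B(1,1,1)$ is the regular bimodule ${}_AA_A$. The $B(k,m,\lambda)$ are called band bimodules. **Proposition 3.1.** For all $k_1,k_2\in\mathbb{Z}_n$, all positive integers $m_1,m_2$ and all non-zero $\lambda_1,\lambda_2\in\Bbbk$, there is an isomorphism of $A$-$A$-bimodules $$B(k_1,m_1,\lambda_1)\otimes_A B(k_2,m_2,\lambda_2)\;\cong\;\bigoplus_{s}B(k_1+k_2-1,\,s,\,\lambda_1\lambda_2),$$ where $s$ runs through the set $\{|m_1-m_2|+1,\ |m_1-m_2|+3,\ \dots,\ m_1+m_2-1\}$. -/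

import Mathlib

open scoped TensorProduct

noncomputable section

namespace BandBimod

universe u v w

/-! ### Bimodules over an algebra -/

/-- A (`K`-linear) `A`-`A`-bimodule, i.e. a left `A ⊗ Aᵐᵒᵖ`-module: a `K`-vector space with a left
and a right action of the `K`-algebra `A` (the right action being a left action of the opposite
algebra) that commute with each other. -/
structure Bimodule (K : Type u) (A : Type v) [Field K] [Ring A] [Algebra K A] where
  /-- the underlying vector space -/
  carrier : Type w
  [addCommGroup : AddCommGroup carrier]
  [module : Module K carrier]
  /-- `left a x` is `a x` -/
  left : A →ₐ[K] Module.End K carrier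
  /-- `right (op a) x` is `x a` -/
  right : Aᵐᵒᵖ →ₐ[K] Module.End K carrier
  /-- `a (x b) = (a x) b` -/
  left_right : ∀ (a b : A) (x : carrier),
    left a (right (MulOpposite.op b) x) = right (MulOpposite.op b) (left a x)

attribute [instance] Bimodule.addCommGroup Bimodule.module

namespace Bimodule

variable {K : Type u} {A : Type v} [Field K] [Ring A] [Algebra K A]

/-- Isomorphism of bimodules: a linear bijection that respects both actions. -/
def IsIso (X : Bimodule K A) (Y : Bimodule K A) : Prop :=
  ∃ e : X.carrier ≃ₗ[K] Y.carrier,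
    (∀ (a : A) (x : X.carrier), e (X.left a x) = Y.left a (e x)) ∧
    (∀ (a : A) (x : X.carrier),
      e (X.right (MulOpposite.op a) x) = Y.right (MulOpposite.op a) (e x))

/-- `X^φ`: the bimodule `X` with the right action twisted by `φ`, i.e. `x · a = x φ(a)`. -/
def twistRight (X : Bimodule K A) (φ : A →ₐ[K] A) : Bimodule K A where
  carrier := X.carrier
  left := X.left
  right := X.right.comp (AlgHom.op φ)
  left_right a b x := X.left_right a (φ b) x

/-- The subspace of `X ⊗[K] Y` spanned by all `x a ⊗ y - x ⊗ a y`. -/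
def balanced (X Y : Bimodule K A) : Submodule K (X.carrier ⊗[K] Y.carrier) :=
  Submodule.span K {z | ∃ (x : X.carrier) (a : A) (y : Y.carrier),
    z = X.right (MulOpposite.op a) x ⊗ₜ[K] y - x ⊗ₜ[K] Y.left a y}

theorem balanced_le_left (X Y : Bimodule K A) (a : A) :
    balanced X Y ≤ (balanced X Y).comap (LinearMap.rTensor Y.carrier (X.left a)) := by
  refine Submodule.span_le.2 ?_
  rintro _ ⟨x, b, y, rfl⟩
  refine Submodule.subset_span ⟨X.left a x, b, y, ?_⟩
  simp [X.left_right]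

theorem balanced_le_right (X Y : Bimodule K A) (a : Aᵐᵒᵖ) :
    balanced X Y ≤ (balanced X Y).comap (LinearMap.lTensor X.carrier (Y.right a)) := by
  refine Submodule.span_le.2 ?_
  rintro _ ⟨x, b, y, rfl⟩
  refine Submodule.subset_span ⟨x, b, Y.right a y, ?_⟩
  have h := Y.left_right b a.unop y
  simp only [MulOpposite.op_unop] at h
  simp [h]

/-- The left action `a (x ⊗ y) = a x ⊗ y` on `X ⊗_A Y`. -/
def tensorLeft (X Y : Bimodule K A) (a : A) :
    Module.End K ((X.carrier ⊗[K] Y.carrier) ⧸ balanced X Y) :=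
  (balanced X Y).mapQ (balanced X Y) (LinearMap.rTensor Y.carrier (X.left a))
    (balanced_le_left X Y a)

/-- The right action `(x ⊗ y) a = x ⊗ y a` on `X ⊗_A Y`. -/
def tensorRight (X Y : Bimodule K A) (a : Aᵐᵒᵖ) :
    Module.End K ((X.carrier ⊗[K] Y.carrier) ⧸ balanced X Y) :=
  (balanced X Y).mapQ (balanced X Y) (LinearMap.lTensor X.carrier (Y.right a))
    (balanced_le_right X Y a)

theorem tensorLeft_mk (X Y : Bimodule K A) (a : A) (z : X.carrier ⊗[K] Y.carrier) :
    tensorLeft X Y a ((balanced X Y).mkQ z) =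
      (balanced X Y).mkQ (LinearMap.rTensor Y.carrier (X.left a) z) := rfl

theorem tensorRight_mk (X Y : Bimodule K A) (a : Aᵐᵒᵖ) (z : X.carrier ⊗[K] Y.carrier) :
    tensorRight X Y a ((balanced X Y).mkQ z) =
      (balanced X Y).mkQ (LinearMap.lTensor X.carrier (Y.right a) z) := rfl

theorem tensor_comm (X Y : Bimodule K A) (a : A) (b : Aᵐᵒᵖ)
    (z : (X.carrier ⊗[K] Y.carrier) ⧸ balanced X Y) :
    tensorLeft X Y a (tensorRight X Y b z) = tensorRight X Y b (tensorLeft X Y a z) := by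
  obtain ⟨z, rfl⟩ := Submodule.mkQ_surjective _ z
  rw [tensorRight_mk, tensorLeft_mk, tensorLeft_mk, tensorRight_mk]
  exact congrArg _ (LinearMap.congr_fun ((LinearMap.rTensor_comp_lTensor ..).trans
    (LinearMap.lTensor_comp_rTensor ..).symm) z)

/-- The tensor product `X ⊗_A Y` over the (noncommutative) algebra `A`: the quotient of
`X ⊗[K] Y` by the relations `x a ⊗ y = x ⊗ a y`, with `a (x ⊗ y) = a x ⊗ y` and
`(x ⊗ y) a = x ⊗ y a`. -/
def tensor (X Y : Bimodule K A) : Bimodule K A where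
  carrier := (X.carrier ⊗[K] Y.carrier) ⧸ balanced X Y
  left := AlgHom.ofLinearMap
    { toFun := tensorLeft X Y
      map_add' := fun a b => Submodule.linearMap_qext _ <| LinearMap.ext fun z => by
        simp only [LinearMap.comp_apply, LinearMap.add_apply, tensorLeft_mk, map_add,
          LinearMap.rTensor_add]
      map_smul' := fun c a => Submodule.linearMap_qext _ <| LinearMap.ext fun z => by
        simp only [LinearMap.comp_apply, LinearMap.smul_apply, tensorLeft_mk, map_smul,
          LinearMap.rTensor_smul, RingHom.id_apply] }
    (Submodule.linearMap_qext _ <| LinearMap.ext fun z => by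
      simp only [LinearMap.comp_apply, LinearMap.coe_mk, AddHom.coe_mk, tensorLeft_mk, map_one,
        Module.End.one_eq_id, LinearMap.rTensor_id, LinearMap.id_apply])
    (fun a b => Submodule.linearMap_qext _ <| LinearMap.ext fun z => by
      simp only [LinearMap.comp_apply, LinearMap.coe_mk, AddHom.coe_mk, tensorLeft_mk, map_mul,
        Module.End.mul_apply, LinearMap.rTensor_mul])
  right := AlgHom.ofLinearMap
    { toFun := tensorRight X Y
      map_add' := fun a b => Submodule.linearMap_qext _ <| LinearMap.ext fun z => by
        simp only [LinearMap.comp_apply, LinearMap.add_apply, tensorRight_mk, map_add,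
          LinearMap.lTensor_add]
      map_smul' := fun c a => Submodule.linearMap_qext _ <| LinearMap.ext fun z => by
        simp only [LinearMap.comp_apply, LinearMap.smul_apply, tensorRight_mk, map_smul,
          LinearMap.lTensor_smul, RingHom.id_apply] }
    (Submodule.linearMap_qext _ <| LinearMap.ext fun z => by
      simp only [LinearMap.comp_apply, LinearMap.coe_mk, AddHom.coe_mk, tensorRight_mk, map_one,
        Module.End.one_eq_id, LinearMap.lTensor_id, LinearMap.id_apply])
    (fun a b => Submodule.linearMap_qext _ <| LinearMap.ext fun z => by
      simp only [LinearMap.comp_apply, LinearMap.coe_mk, AddHom.coe_mk, tensorRight_mk, map_mul,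
        Module.End.mul_apply, LinearMap.lTensor_mul])
  left_right a b z := tensor_comm X Y a (MulOpposite.op b) z

/-- The direct sum of a finite family of bimodules, realised on the product of the underlying
vector spaces, with componentwise actions. -/
def directSum {ι : Type} [Finite ι] (X : ι → Bimodule.{u, v, w} K A) : Bimodule.{u, v, w} K A where
  carrier := ∀ i, (X i).carrier
  left := AlgHom.ofLinearMap
    { toFun := fun a => LinearMap.pi fun i => (X i).left a ∘ₗ LinearMap.proj i
      map_add' := fun a b => by ext; simp
      map_smul' := fun c a => by ext; simp }
    (by ext; simp) (fun a b => by ext; simp)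
  right := AlgHom.ofLinearMap
    { toFun := fun a => LinearMap.pi fun i => (X i).right a ∘ₗ LinearMap.proj i
      map_add' := fun a b => by ext; simp
      map_smul' := fun c a => by ext; simp }
    (by ext; simp) (fun a b => by ext; simp)
  left_right a b x := by
    funext i
    exact (X i).left_right a b (x i)

end Bimodule

/-! ### The radical square zero Nakayama algebra of the cyclic quiver -/

/-- The trivial paths `ε_i` and the arrows `α_i : i ⟶ i + 1` of the cyclic quiver with vertex set
`ℤ/n` (for `n = 1`: one vertex and one loop). -/
inductive Gen (n : ℕ) : Type
  | vertex (i : ZMod n) : Gen n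
  | arrow (i : ZMod n) : Gen n

section Algebra

variable (K : Type u) [Field K] (n : ℕ) [NeZero n]

/-- The free generator `ε_i`. -/
def freeE (i : ZMod n) : FreeAlgebra K (Gen n) := FreeAlgebra.ι K (Gen.vertex i)

/-- The free generator `α_i`. -/
def freeA (i : ZMod n) : FreeAlgebra K (Gen n) := FreeAlgebra.ι K (Gen.arrow i)

/-- The relations of the path algebra of the cyclic quiver, where paths are composed from right to
left, so that `α_i = ε_{i+1} α_i ε_i`, together with the relations that all paths of length two
are zero (the product of two arrows that do not compose is zero in any path algebra). -/
inductive Rel : FreeAlgebra K (Gen n) → FreeAlgebra K (Gen n) → Prop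
  | idem (i : ZMod n) : Rel (freeE K n i * freeE K n i) (freeE K n i)
  | orth (i j : ZMod n) (h : i ≠ j) : Rel (freeE K n i * freeE K n j) 0
  | sum_one : Rel (∑ i : ZMod n, freeE K n i) 1
  | target (i : ZMod n) : Rel (freeE K n (i + 1) * freeA K n i) (freeA K n i)
  | source (i : ZMod n) : Rel (freeA K n i * freeE K n i) (freeA K n i)
  | rad_sq (i j : ZMod n) : Rel (freeA K n i * freeA K n j) 0

/-- The algebra `Q_n`: the path algebra of the cyclic quiver with `n` vertices modulo all paths of
length two; for `n = 1` this is the algebra of dual numbers. -/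
abbrev Q : Type u := RingQuot (Rel K n)

/-- The primitive idempotent `ε_i` of `Q_n`. -/
def ε (i : ZMod n) : Q K n := RingQuot.mkAlgHom K (Rel K n) (freeE K n i)

/-- The arrow `α_i` as an element of `Q_n`. -/
def α (i : ZMod n) : Q K n := RingQuot.mkAlgHom K (Rel K n) (freeA K n i)

variable {K n}

theorem ε_idem (i : ZMod n) : ε K n i * ε K n i = ε K n i := by
  simpa [ε] using RingQuot.mkAlgHom_rel K (Rel.idem (K := K) i)

theorem ε_orth {i j : ZMod n} (h : i ≠ j) : ε K n i * ε K n j = 0 := by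
  simpa [ε] using RingQuot.mkAlgHom_rel K (Rel.orth (K := K) i j h)

theorem sum_ε : ∑ i : ZMod n, ε K n i = 1 := by
  simpa [ε] using RingQuot.mkAlgHom_rel K (Rel.sum_one (K := K) (n := n))

theorem ε_mul_α (i : ZMod n) : ε K n (i + 1) * α K n i = α K n i := by
  simpa [ε, α] using RingQuot.mkAlgHom_rel K (Rel.target (K := K) i)

theorem α_mul_ε (i : ZMod n) : α K n i * ε K n i = α K n i := by
  simpa [ε, α] using RingQuot.mkAlgHom_rel K (Rel.source (K := K) i)

theorem α_mul_α (i j : ZMod n) : α K n i * α K n j = 0 := by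
  simpa [α] using RingQuot.mkAlgHom_rel K (Rel.rad_sq (K := K) i j)

/-- The algebra homomorphism out of `Q_n` given by the images of the `ε_i` and the `α_i`. -/
def Q.lift {B : Type w} [Ring B] [Algebra K B] (e a : ZMod n → B)
    (idem : ∀ i, e i * e i = e i) (orth : ∀ i j, i ≠ j → e i * e j = 0)
    (sum_one : ∑ i, e i = 1) (target : ∀ i, e (i + 1) * a i = a i)
    (source : ∀ i, a i * e i = a i) (rad_sq : ∀ i j, a i * a j = 0) : Q K n →ₐ[K] B :=
  RingQuot.liftAlgHom K ⟨FreeAlgebra.lift K fun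
    | Gen.vertex i => e i
    | Gen.arrow i => a i, by
      intro x y h
      induction h with
      | idem i => simp [freeE, idem]
      | orth i j h => simp [freeE, orth i j h]
      | sum_one => simp [freeE, sum_one]
      | target i => simp [freeE, freeA, target]
      | source i => simp [freeE, freeA, source]
      | rad_sq i j => simp [freeA, rad_sq]⟩

variable (K n)

/-- The rotation `θ` of `Q_n`: `ε_i ↦ ε_{i+1}` and `α_i ↦ α_{i+1}`. -/
def θ : Q K n →ₐ[K] Q K n :=
  Q.lift (fun i => ε K n (i + 1)) (fun i => α K n (i + 1))
    (fun i => ε_idem _) (fun i j h => ε_orth (by simpa using h))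
    (by rw [← sum_ε (K := K) (n := n)]
        exact Equiv.sum_comp (Equiv.addRight (1 : ZMod n)) (fun i => ε K n i))
    (fun i => ε_mul_α _) (fun i => α_mul_ε _) (fun i j => α_mul_α _ _)

end Algebra

/-! ### Band bimodules -/

section Band

variable (K : Type u) [Field K] (n : ℕ) [NeZero n]

/-- The Jordan cell `J_m(c)`: `c` on the diagonal and `1` on the superdiagonal. -/
def jordanCell (m : ℕ) (c : K) : Matrix (Fin m) (Fin m) K :=
  Matrix.of fun i j => if i = j then c else if (i : ℕ) + 1 = j then 1 else 0

/-- The space of the band bimodule `B(1, m, c)`. A pair `(t, b)` has component `t i ∈ K^m` at the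
vertex `i|i` and component `b i ∈ K^m` at the vertex `(i+1)|i`. (For `n = 1` these two vertices
coincide and the value there is `K^m ⊕ K^m`.) -/
abbrev BandSpace (m : ℕ) : Type u := (ZMod n → Fin m → K) × (ZMod n → Fin m → K)

variable {n}

/-- Left action of `ε_j`: the projection to the vertices `j|*`. -/
def leftE (m : ℕ) (j : ZMod n) : Module.End K (BandSpace K n m) where
  toFun x := (fun i => if i = j then x.1 i else 0, fun i => if i + 1 = j then x.2 i else 0)
  map_add' x y := by ext <;> simp <;> split_ifs <;> simp
  map_smul' c x := by ext <;> simp <;> split_ifs <;> simp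

/-- Left action of `α_j`: the identity from the vertex `j|j` to the vertex `(j+1)|j`. -/
def leftA (m : ℕ) (j : ZMod n) : Module.End K (BandSpace K n m) where
  toFun x := (0, fun i => if i = j then x.1 j else 0)
  map_add' x y := by ext <;> simp <;> split_ifs <;> simp
  map_smul' c x := by ext <;> simp <;> split_ifs <;> simp

/-- Right action of `ε_j`: the projection to the vertices `*|j`. -/
def rightE (m : ℕ) (j : ZMod n) : Module.End K (BandSpace K n m) where
  toFun x := (fun i => if i = j then x.1 i else 0, fun i => if i = j then x.2 i else 0)
  map_add' x y := by ext <;> simp <;> split_ifs <;> simp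
  map_smul' c x := by ext <;> simp <;> split_ifs <;> simp

variable {K} in
/-- Right action of `α_j`, from the vertex `(j+1)|(j+1)` to the vertex `(j+1)|j`: the Jordan cell
`J_m(c)` for `j = 1` and the identity for all other `j`. -/
def rightA (m : ℕ) (c : K) (j : ZMod n) : Module.End K (BandSpace K n m) where
  toFun x := (0, fun i => if i = j then
    (if j = 1 then (jordanCell K m c).mulVec (x.1 (j + 1)) else x.1 (j + 1)) else 0)
  map_add' x y := by ext <;> simp [Matrix.mulVec_add] <;> split_ifs <;> simp
  map_smul' c x := by ext <;> simp [Matrix.mulVec_smul] <;> split_ifs <;> simp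

variable (n) {K}

/-- The left action of `Q_n` on `B(1, m, c)`. -/
def bandLeft (m : ℕ) : Q K n →ₐ[K] Module.End K (BandSpace K n m) :=
  Q.lift (leftE K m) (leftA K m)
    (fun j => by
      refine LinearMap.ext fun x => Prod.ext (funext fun i => ?_) (funext fun i => ?_) <;>
        simp only [leftE, Module.End.mul_apply, LinearMap.coe_mk, AddHom.coe_mk] <;>
        split_ifs <;> rfl)
    (fun j l h => by
      refine LinearMap.ext fun x => Prod.ext (funext fun i => ?_) (funext fun i => ?_) <;>
        simp only [leftE, Module.End.mul_apply, LinearMap.coe_mk, AddHom.coe_mk] <;>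
        split_ifs with h1 h2 <;> first | rfl | exact absurd (h1.symm.trans h2) h)
    (by
      refine LinearMap.ext fun x => Prod.ext (funext fun i => ?_) (funext fun i => ?_) <;>
        simp [leftE, LinearMap.sum_apply, Prod.fst_sum, Prod.snd_sum, Finset.sum_apply])
    (fun j => by
      refine LinearMap.ext fun x => Prod.ext (funext fun i => ?_) (funext fun i => ?_) <;>
        simp +contextual [leftE, leftA])
    (fun j => by
      refine LinearMap.ext fun x => Prod.ext (funext fun i => ?_) (funext fun i => ?_) <;>
        simp [leftE, leftA])
    (fun j l => by
      refine LinearMap.ext fun x => Prod.ext (funext fun i => ?_) (funext fun i => ?_) <;>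
        simp [leftA])

/-- The right action of `Q_n` on `B(1, m, c)`. -/
def bandRight (m : ℕ) (c : K) : (Q K n)ᵐᵒᵖ →ₐ[K] Module.End K (BandSpace K n m) :=
  AlgHom.opComm (Q.lift (fun j => MulOpposite.op (rightE K m j))
    (fun j => MulOpposite.op (rightA m c j))
    (fun j => by
      rw [← MulOpposite.op_mul]
      congr 1
      refine LinearMap.ext fun x => Prod.ext (funext fun i => ?_) (funext fun i => ?_) <;>
        simp only [rightE, Module.End.mul_apply, LinearMap.coe_mk, AddHom.coe_mk] <;>
        split_ifs <;> rfl)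
    (fun j l h => by
      rw [← MulOpposite.op_mul, ← MulOpposite.op_zero]
      congr 1
      refine LinearMap.ext fun x => Prod.ext (funext fun i => ?_) (funext fun i => ?_) <;>
        simp only [rightE, Module.End.mul_apply, LinearMap.coe_mk, AddHom.coe_mk] <;>
        split_ifs with h1 h2 <;> first | rfl | exact absurd (h2.symm.trans h1) h)
    (by
      rw [← MulOpposite.op_one, ← Finset.op_sum]
      congr 1
      refine LinearMap.ext fun x => Prod.ext (funext fun i => ?_) (funext fun i => ?_) <;>
        simp [rightE, LinearMap.sum_apply, Prod.fst_sum, Prod.snd_sum, Finset.sum_apply])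
    (fun j => by
      rw [← MulOpposite.op_mul]
      congr 1
      refine LinearMap.ext fun x => Prod.ext (funext fun i => ?_) (funext fun i => ?_) <;>
        simp [rightE, rightA])
    (fun j => by
      rw [← MulOpposite.op_mul]
      congr 1
      refine LinearMap.ext fun x => Prod.ext (funext fun i => ?_) (funext fun i => ?_) <;>
        simp +contextual [rightE, rightA])
    (fun j l => by
      rw [← MulOpposite.op_mul, ← MulOpposite.op_zero]
      congr 1
      refine LinearMap.ext fun x => Prod.ext (funext fun i => ?_) (funext fun i => ?_) <;>
        simp [rightA]))

theorem Q.lift_ε {B : Type w} [Ring B] [Algebra K B] (e a : ZMod n → B) (h₁ h₂ h₃ h₄ h₅ h₆)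
    (i : ZMod n) : Q.lift e a h₁ h₂ h₃ h₄ h₅ h₆ (ε K n i) = e i := by
  simp [Q.lift, ε, freeE]

theorem Q.lift_α {B : Type w} [Ring B] [Algebra K B] (e a : ZMod n → B) (h₁ h₂ h₃ h₄ h₅ h₆)
    (i : ZMod n) : Q.lift e a h₁ h₂ h₃ h₄ h₅ h₆ (α K n i) = a i := by
  simp [Q.lift, α, freeA]

/-- `Q_n` is generated by the `ε_i` and the `α_i`. -/
theorem Q.induction {p : Q K n → Prop} (hE : ∀ i, p (ε K n i)) (hA : ∀ i, p (α K n i))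
    (hs : ∀ c : K, p (algebraMap K _ c)) (hadd : ∀ a b, p a → p b → p (a + b))
    (hmul : ∀ a b, p a → p b → p (a * b)) (a : Q K n) : p a := by
  obtain ⟨a, rfl⟩ := RingQuot.mkAlgHom_surjective K (Rel K n) a
  induction a using FreeAlgebra.induction with
  | grade0 c => simpa using hs c
  | grade1 g =>
    cases g with
    | vertex i => exact hE i
    | arrow i => exact hA i
  | mul a b ha hb => simpa using hmul _ _ ha hb
  | add a b ha hb => simpa using hadd _ _ ha hb

theorem band_comm (m : ℕ) (c : K) (a b : Q K n) (x : BandSpace K n m) :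
    bandLeft n m a (bandRight n m c (MulOpposite.op b) x) =
      bandRight n m c (MulOpposite.op b) (bandLeft n m a x) := by
  have hE : ∀ j, bandRight n m c (MulOpposite.op (ε K n j)) = rightE K m j := fun j =>
    congrArg MulOpposite.unop (Q.lift_ε ..)
  have hA : ∀ j, bandRight n m c (MulOpposite.op (α K n j)) = rightA m c j := fun j =>
    congrArg MulOpposite.unop (Q.lift_α ..)
  have hE' : ∀ j, bandLeft (K := K) n m (ε K n j) = leftE K m j := fun j => Q.lift_ε ..
  have hA' : ∀ j, bandLeft (K := K) n m (α K n j) = leftA K m j := fun j => Q.lift_α ..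
  have key : ∀ f : Module.End K (BandSpace K n m), (∀ j, Commute f (rightE K m j)) →
      (∀ j, Commute f (rightA m c j)) → ∀ b, Commute f (bandRight n m c (MulOpposite.op b)) := by
    intro f h₁ h₂ b
    induction b using Q.induction with
    | hE j => rw [hE]; exact h₁ j
    | hA j => rw [hA]; exact h₂ j
    | hs r =>
      rw [← MulOpposite.algebraMap_apply, AlgHom.commutes]
      exact (Algebra.commutes r f).symm
    | hadd a b ha hb => rw [MulOpposite.op_add, map_add]; exact ha.add_right hb
    | hmul a b ha hb => rw [MulOpposite.op_mul, map_mul]; exact hb.mul_right ha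
  have main : Commute (bandLeft n m a) (bandRight n m c (MulOpposite.op b)) := by
    induction a using Q.induction with
    | hE j =>
      rw [hE']
      refine key _ (fun l => ?_) (fun l => ?_) b <;>
        refine LinearMap.ext fun x => Prod.ext (funext fun i => ?_) (funext fun i => ?_) <;>
        simp [leftE, rightE, rightA] <;> split_ifs <;> simp_all
    | hA j =>
      rw [hA']
      refine key _ (fun l => ?_) (fun l => ?_) b <;>
        refine LinearMap.ext fun x => Prod.ext (funext fun i => ?_) (funext fun i => ?_) <;>
        simp [leftA, rightE, rightA] <;> split_ifs <;> simp_all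
    | hs r => rw [AlgHom.commutes]; exact Algebra.commutes r _
    | hadd a b ha hb => rw [map_add]; exact ha.add_left hb
    | hmul a b ha hb => rw [map_mul]; exact ha.mul_left hb
  exact LinearMap.congr_fun main.eq x

/-- The band bimodule `B(1, m, c)`. -/
def bandOne (m : ℕ) (c : K) : Bimodule.{u, u, u} K (Q K n) where
  carrier := BandSpace K n m
  left := bandLeft n m
  right := bandRight n m c
  left_right := band_comm n m c

/-- The band bimodule `B(k, m, c)`, which is `B(1, m, c)` with the right action twisted by
`θ^{k-1}`. -/
def band (k : ZMod n) (m : ℕ) (c : K) : Bimodule.{u, u, u} K (Q K n) :=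
  (bandOne n m c).twistRight (θ K n ^ (k - 1).val)

end Band

/-- The set `{|m₁ - m₂| + 1, |m₁ - m₂| + 3, …, m₁ + m₂ - 1}`. -/
def summandSizes (m₁ m₂ : ℕ) : Finset ℕ :=
  (Finset.Icc (((m₁ : ℤ) - m₂).natAbs + 1) (m₁ + m₂ - 1)).filter fun s =>
    s ≡ ((m₁ : ℤ) - m₂).natAbs + 1 [MOD 2]

end BandBimod

end

open scoped TensorProduct

noncomputable section

namespace BandBimod

open Polynomial

/-! A band bimodule is a cyclic representation: spaces `T_i` at `i|i` and `S_i` at `(i+1)|i`, with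
all left arrows identities and right arrows `P i : T_{i+1} → S_i`. When the `P i` are invertible,
such a representation depends up to isomorphism only on its twist and on the holonomy, the product
of the `P i` around the cycle up to conjugacy.

Tensor products over `Q_n` stay in this form. Since `S_l = α_l T_l` in the right factor, every
tensor can be rewritten with a right entry in some `T_l`, and `ε_l` then selects one block of the
left factor. The result has space `V ⊗ W` at every vertex, right arrows `P i ⊗ R (i - d)`, and the
sum of the two twists (`IsCoordinates.tensor`). For band bimodules the only nontrivial arrow maps
are `J_{m₁}(c₁) ⊗ 1` at `1` and `1 ⊗ J_{m₂}(c₂)` at `k₁`. As the latter is invertible, a change of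
basis along the cycle collects both at `1` (`exists_straighten`), giving the holonomy `J_{m₁}(c₁) ⊗
J_{m₂}(c₂)`.

It remains to decompose this tensor product in characteristic zero
(`exists_equiv_jordanCell_tensor`). The cell `J_m(c)` is `c` times the translation `f(X) ↦ f(X + 1)`
on polynomials of degree less than `m`. The tensor product becomes `c₁ c₂` times the diagonal
translation on polynomials in `X, Y` of bounded bidegree. That translation fixes `X - Y`, so its
difference operator `D` commutes with multiplication by `X - Y`. Hence `(X - Y)^j binom(X, p)
binom(Y, q)`, with `p = m₁ - 1 - j` and `q = m₂ - 1 - j`, starts a Jordan chain of length `p + q + 1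
= m₁ + m₂ - 1 - 2j` ending in a nonzero multiple of `(X - Y)^j`. These end vectors are independent
and the lengths add up to `m₁ m₂`, so the chains form a Jordan basis. -/

theorem jordanCell_mulVec {K : Type*} [Field K] (m : ℕ) (c : K) (x : Fin m → K) (i : Fin m) :
    (jordanCell K m c).mulVec x i =
      c * x i + if h : (i : ℕ) + 1 < m then x ⟨i + 1, h⟩ else 0 := by
  have hs : ∀ j : Fin m, jordanCell K m c i j * x j =
      (if i = j then c * x j else 0) + if (i : ℕ) + 1 = j then x j else 0 := by
    intro j
    by_cases h : i = j
    · subst h; simp [jordanCell]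
    · simp [jordanCell, h]
  simp only [Matrix.mulVec, dotProduct, hs, Finset.sum_add_distrib, Finset.sum_ite_eq,
    Finset.mem_univ, if_true]
  congr 1
  split_ifs with h
  · rw [Finset.sum_eq_single (⟨i + 1, h⟩ : Fin m)] <;> simp +contextual [Fin.ext_iff, eq_comm]
  · exact Finset.sum_eq_zero fun j _ => if_neg (by have := j.2; omega)

theorem jordanCell_mulVec_eq_smul_add {K : Type*} [Field K] (m : ℕ) (c : K) (x : Fin m → K) :
    (jordanCell K m c).mulVec x = c • x + (jordanCell K m 0).mulVec x := by
  ext i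
  simp [jordanCell_mulVec]

/-! ### Jordan bases from chains of a nilpotent operator -/

section Chains

variable {K V ι : Type*} [Field K] [AddCommGroup V] [Module K V] [Fintype ι]

/-- The linear map sending the standard basis of `∏ j, K^{s j}` to the vectors
`N^{s j - 1 - i} (v j)`. -/
def chainMap (N : Module.End K V) (s : ι → ℕ) (v : ι → V) :
    (∀ j, Fin (s j) → K) →ₗ[K] V where
  toFun a := ∑ j, ∑ i : Fin (s j), a j i • (N ^ (s j - 1 - i)) (v j)
  map_add' a b := by simp [add_smul, Finset.sum_add_distrib]
  map_smul' r a := by simp [Finset.smul_sum, mul_smul]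

/-- The exponent `s - 1 - i` decreases with `i`, so `N` moves the basis vector of index `i + 1` to
that of index `i` and kills index `0`. This matches the superdiagonal convention for Jordan cells.
-/
theorem apply_chain_sum (N : Module.End K V) (s : ℕ) (v : V) (hv : (N ^ s) v = 0)
    (a : Fin s → K) :
    N (∑ i, a i • (N ^ (s - 1 - i)) v) =
      ∑ i, (jordanCell K s 0).mulVec a i • (N ^ (s - 1 - i)) v := by
  cases s with
  | zero => simp
  | succ m =>
    rw [map_sum, Fin.sum_univ_succ, Fin.sum_univ_castSucc]
    simp only [map_smul, ← Module.End.mul_apply, ← pow_succ', jordanCell_mulVec]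
    rw [add_comm]
    congr 1
    · refine Finset.sum_congr rfl fun i _ => ?_
      have h1 : m + 1 - 1 - (i.succ : ℕ) + 1 = m + 1 - 1 - (i.castSucc : ℕ) := by
        have := i.2
        simp only [Fin.val_succ, Fin.val_castSucc]
        omega
      rw [h1]
      have : (i.castSucc : ℕ) + 1 < m + 1 := by simp
      rw [dif_pos this]
      simp only [zero_mul, zero_add]
      rfl
    · simp [hv]

theorem apply_chainMap (N : Module.End K V) (s : ι → ℕ) (v : ι → V)
    (hv : ∀ j, (N ^ s j) (v j) = 0) (a : ∀ j, Fin (s j) → K) :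
    N (chainMap N s v a) = chainMap N s v (fun j => (jordanCell K (s j) 0).mulVec (a j)) := by
  refine (map_sum N _ _).trans ?_
  exact Finset.sum_congr rfl fun j _ => apply_chain_sum N (s j) (v j) (hv j) (a j)

/-- Applying `N` to a relation shifts its coefficients down by one index, so induction on the
highest index occurring kills every coefficient of positive index. What is left is a relation among
the end vectors of the chains, which are independent by hypothesis. -/
theorem chainMap_injective (N : Module.End K V) (s : ι → ℕ) (v : ι → V)
    (hv : ∀ j, (N ^ s j) (v j) = 0)
    (hli : LinearIndependent K fun j => (N ^ (s j - 1)) (v j)) :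
    Function.Injective (chainMap N s v) := by
  have key : ∀ k : ℕ, ∀ a : ∀ j, Fin (s j) → K, (∀ j (i : Fin (s j)), k ≤ (i : ℕ) → a j i = 0) →
      chainMap N s v a = 0 → a = 0 := by
    intro k
    induction k with
    | zero => exact fun a ha _ => funext fun j => funext fun i => ha j i (Nat.zero_le _)
    | succ k ih =>
      intro a ha h
      have hshift := ih (fun j => (jordanCell K (s j) 0).mulVec (a j)) (fun j i hi => by
        rw [jordanCell_mulVec]
        split_ifs with h'
        · simp [ha j ⟨i + 1, h'⟩ (by simpa using hi)]
        · simp) (by rw [← apply_chainMap N s v hv, h, map_zero])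
      have hpos : ∀ j (i : Fin (s j)), 0 < (i : ℕ) → a j i = 0 := by
        intro j i hi
        have h1 := congrFun (congrFun hshift j) ⟨i - 1, by omega⟩
        simp only [jordanCell_mulVec, zero_mul, zero_add, Pi.zero_apply] at h1
        rw [dif_pos (by omega)] at h1
        rw [← h1]
        congr 1
        ext
        simp only
        omega
      -- The coefficients of the end vectors; a chain of length `0` has no coefficient and receives
      -- the value `0`.
      let b : ι → K := fun j => if h : 0 < s j then a j ⟨0, h⟩ else 0
      have hb : ∑ j, b j • (N ^ (s j - 1)) (v j) = 0 := by
        rw [← h]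
        refine Finset.sum_congr rfl fun j _ => ?_
        by_cases hj : 0 < s j
        · rw [Finset.sum_eq_single (⟨0, hj⟩ : Fin (s j))]
          · simp [b, hj]
          · intro i _ hi
            rw [hpos j i (Nat.pos_of_ne_zero fun h0 => hi (Fin.ext h0)), zero_smul]
          · simp
        · have : IsEmpty (Fin (s j)) := by
            rw [Nat.eq_zero_of_not_pos hj]; infer_instance
          simp [b, hj]
      have hb0 := Fintype.linearIndependent_iff.1 hli b hb
      funext j i
      by_cases hi : 0 < (i : ℕ)
      · exact hpos j i hi
      · have h0 := hb0 j
        have hj : 0 < s j := i.pos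
        simp only [b, dif_pos hj] at h0
        have hi0 : i = ⟨0, hj⟩ := Fin.ext (Nat.eq_zero_of_not_pos hi)
        rw [hi0]
        exact h0
  refine (injective_iff_map_eq_zero _).2 fun a ha => ?_
  -- The total length bounds every index, so the vanishing condition of `key` is vacuous there.
  refine key (∑ j, s j) a (fun j i hi => ?_) ha
  have : s j ≤ ∑ j, s j := Finset.single_le_sum (f := s) (fun _ _ => Nat.zero_le _)
    (Finset.mem_univ j)
  have := i.2
  omega

/-- A linear map `c + N` with Jordan chains starting at the `v j` of lengths `s j`, whose last
vectors are linearly independent and whose lengths add up to the dimension, is the direct sum of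
the Jordan cells `J_{s j}(c)`. -/
theorem exists_equiv_of_chains [FiniteDimensional K V] (c : K) (N : Module.End K V) (s : ι → ℕ)
    (v : ι → V) (hv : ∀ j, (N ^ s j) (v j) = 0)
    (hli : LinearIndependent K fun j => (N ^ (s j - 1)) (v j))
    (hdim : ∑ j, s j = Module.finrank K V) :
    ∃ g : V ≃ₗ[K] (∀ j, Fin (s j) → K),
      ∀ x j, g (c • x + N x) j = (jordanCell K (s j) c).mulVec (g x j) := by
  have hfin : Module.finrank K (∀ j, Fin (s j) → K) = Module.finrank K V := by
    rw [Module.finrank_pi_fintype]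
    simpa using hdim
  let e := LinearEquiv.ofInjectiveOfFinrankEq (chainMap N s v) (chainMap_injective N s v hv hli)
    hfin
  refine ⟨e.symm, fun x j => ?_⟩
  obtain ⟨a, rfl⟩ := e.surjective x
  have h : N (e a) = e (fun j => (jordanCell K (s j) 0).mulVec (a j)) := apply_chainMap N s v hv a
  rw [h, ← map_smul, ← map_add, e.symm_apply_apply, e.symm_apply_apply,
    jordanCell_mulVec_eq_smul_add]
  rfl

end Chains

/-! ### The difference operator on polynomials in one and two variables -/

section Translation

variable (K : Type*) [Field K]

/-- The polynomial `X (X - 1) ⋯ (X - k + 1) / k!`. -/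
def binomPoly (k : ℕ) : K[X] := C ((k.factorial : K)⁻¹) * descPochhammer K k

theorem binomPoly_zero : binomPoly K 0 = 1 := by simp [binomPoly]

theorem binomPoly_mem_degreeLT (k : ℕ) : binomPoly K k ∈ degreeLT K (k + 1) := by
  rw [binomPoly, ← smul_eq_C_mul]
  refine Submodule.smul_mem _ _ (mem_degreeLT.2 ?_)
  refine lt_of_le_of_lt degree_le_natDegree ?_
  rw [descPochhammer_natDegree]
  exact_mod_cast Nat.lt_succ_self k

theorem taylor_binomPoly_succ [CharZero K] (k : ℕ) :
    taylor 1 (binomPoly K (k + 1)) = binomPoly K (k + 1) + binomPoly K k := by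
  -- The quoted identity is a backward difference; substituting `X + 1` turns it into the forward
  -- difference, and the factor `k + 1` is then absorbed by the factorials.
  have h := congrArg (fun p : K[X] => p.comp (X + C 1)) (descPochhammer_succ_comp_X_sub_one K k)
  have hX : ((X : K[X]) - 1).comp (X + C 1) = X := by simp
  simp only [comp_assoc, hX, comp_X, sub_comp, smul_eq_mul, mul_comp] at h
  have hk : ((k : K[X]) + 1).comp (X + C 1) = C ((k : K) + 1) := by simp
  rw [hk, ← taylor_apply, eq_sub_iff_add_eq] at h
  have hne : (k : K) + 1 ≠ 0 := by exact_mod_cast Nat.succ_ne_zero k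
  have hc : (((k + 1).factorial : K)⁻¹) * ((k : K) + 1) = (k.factorial : K)⁻¹ := by
    rw [Nat.factorial_succ]
    push_cast
    field_simp
  rw [binomPoly, binomPoly, taylor_mul, taylor_C, ← h, mul_add, ← hc, map_mul, mul_assoc]

/-- The diagonal translation `f(X, Y) ↦ f(X + 1, Y + 1)`. -/
def diagTaylor : K[X] ⊗[K] K[X] →ₐ[K] K[X] ⊗[K] K[X] :=
  Algebra.TensorProduct.map (taylorAlgHom 1) (taylorAlgHom 1)

/-- The difference operator `f(X, Y) ↦ f(X + 1, Y + 1) - f(X, Y)`. -/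
def diagDiff : Module.End K (K[X] ⊗[K] K[X]) := (diagTaylor K).toLinearMap - 1

/-- The element `X - Y`. -/
def diagVar : K[X] ⊗[K] K[X] := X ⊗ₜ[K] 1 - 1 ⊗ₜ[K] X

variable {K}

theorem diagDiff_apply (z : K[X] ⊗[K] K[X]) : diagDiff K z = diagTaylor K z - z := rfl

theorem diagTaylor_tmul (p q : K[X]) :
    diagTaylor K (p ⊗ₜ[K] q) = taylor 1 p ⊗ₜ[K] taylor 1 q := rfl

theorem diagTaylor_diagVar : diagTaylor K (diagVar K) = diagVar K := by
  simp [diagVar, diagTaylor_tmul, TensorProduct.add_tmul, TensorProduct.tmul_add]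

/-- The diagonal translation is a ring homomorphism fixing `X - Y`, so the difference operator is
linear over the powers of `X - Y`. -/
theorem diagDiff_pow_mul (j k : ℕ) (z : K[X] ⊗[K] K[X]) :
    (diagDiff K ^ k) (diagVar K ^ j * z) = diagVar K ^ j * (diagDiff K ^ k) z := by
  induction k generalizing z with
  | zero => simp
  | succ k ih =>
    rw [pow_succ, Module.End.mul_apply, Module.End.mul_apply, ← ih]
    simp [diagDiff_apply, diagTaylor_diagVar, mul_sub]

/-- With `Δ = τ - 1` on each factor, `τ ⊗ τ - 1 = Δ ⊗ 1 + 1 ⊗ Δ + Δ ⊗ Δ`, and `Δ` lowers the index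
of `binomPoly` by one. -/
theorem diagDiff_binom [CharZero K] (p q : ℕ) :
    diagDiff K (binomPoly K p ⊗ₜ[K] binomPoly K q) =
      (if p = 0 then 0 else binomPoly K (p - 1) ⊗ₜ[K] binomPoly K q) +
      (if q = 0 then 0 else binomPoly K p ⊗ₜ[K] binomPoly K (q - 1)) +
      (if p = 0 ∨ q = 0 then 0 else binomPoly K (p - 1) ⊗ₜ[K] binomPoly K (q - 1)) := by
  rcases p with _ | p <;> rcases q with _ | q <;>
    simp [diagDiff_apply, diagTaylor_tmul, taylor_binomPoly_succ, binomPoly_zero,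
      TensorProduct.add_tmul, TensorProduct.tmul_add]
  abel

theorem diagDiff_pow_binom_eq_zero [CharZero K] (k p q : ℕ) (h : p + q < k) :
    (diagDiff K ^ k) (binomPoly K p ⊗ₜ[K] binomPoly K q) = 0 := by
  induction k generalizing p q with
  | zero => omega
  | succ k ih =>
    rw [pow_succ, Module.End.mul_apply, diagDiff_binom]
    simp only [map_add]
    split_ifs <;> simp (disch := omega) [ih]

/-- The mixed term `Δ ⊗ Δ` lowers the total degree by two and is killed by the remaining powers. The
other two terms reproduce Pascal's rule. -/
theorem diagDiff_pow_binom [CharZero K] (k p q : ℕ) (h : p + q = k) :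
    (diagDiff K ^ k) (binomPoly K p ⊗ₜ[K] binomPoly K q) = (k.choose p : K) • 1 := by
  induction k generalizing p q with
  | zero =>
    obtain ⟨rfl, rfl⟩ : p = 0 ∧ q = 0 := by omega
    simp [binomPoly_zero, Algebra.TensorProduct.one_def]
  | succ k ih =>
    rw [pow_succ, Module.End.mul_apply, diagDiff_binom]
    rcases p with _ | p <;> rcases q with _ | q
    · omega
    · obtain rfl : q = k := by omega
      simpa using ih 0 q (by omega)
    · obtain rfl : p = k := by omega
      simpa using ih p 0 (by omega)
    · simp only [map_add]
      simp only [Nat.add_eq_zero_iff, one_ne_zero, and_false, or_self, if_false,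
        Nat.add_sub_cancel]
      rw [ih _ _ (by omega), ih _ _ (by omega), diagDiff_pow_binom_eq_zero _ _ _ (by omega),
        add_zero, ← add_smul, Nat.choose_succ_succ]
      push_cast
      rfl

/-- Setting `Y = 0` sends `(X - Y)^j` to `X^j`. -/
theorem linearIndependent_diagVar_pow : LinearIndependent K fun j : ℕ => diagVar K ^ j := by
  let φ : K[X] ⊗[K] K[X] →ₐ[K] K[X] :=
    Algebra.TensorProduct.lift (AlgHom.id K K[X]) (aeval (0 : K[X])) fun _ _ => Commute.all _ _
  have hφ : φ (diagVar K) = X := by simp [φ, diagVar]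
  refine LinearIndependent.of_comp φ.toLinearMap ?_
  have : (φ.toLinearMap ∘ fun j : ℕ => diagVar K ^ j) = fun j : ℕ => (X : K[X]) ^ j := by
    funext j
    simp [hφ]
  rw [this]
  simpa [Polynomial.coe_basisMonomials, ← Polynomial.X_pow_eq_monomial] using
    (Polynomial.basisMonomials K).linearIndependent

/-- Multiplication by `X - Y` raises each of the two degrees by at most one. This keeps the chain
starts inside the space of bounded bidegree. -/
theorem diagVar_mul_mem (m n : ℕ) (z : K[X] ⊗[K] K[X])
    (hz : z ∈ LinearMap.range (TensorProduct.mapIncl (degreeLT K m) (degreeLT K n))) :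
    diagVar K * z ∈
      LinearMap.range (TensorProduct.mapIncl (degreeLT K (m + 1)) (degreeLT K (n + 1))) := by
  rw [TensorProduct.range_mapIncl] at hz ⊢
  have hmul : ∀ (k : ℕ) (f : K[X]), f ∈ degreeLT K k → X * f ∈ degreeLT K (k + 1) := by
    intro k f hf
    rw [mem_degreeLT] at hf ⊢
    rw [degree_mul, degree_X]
    calc (1 : WithBot ℕ) + f.degree < 1 + k := by
          exact WithBot.add_lt_add_left (by simp) hf
      _ = ((k + 1 : ℕ) : WithBot ℕ) := by push_cast; rw [add_comm]
  have hmono : ∀ k, degreeLT K k ≤ degreeLT K (k + 1) := fun k => degreeLT_mono (Nat.le_succ k)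
  suffices h : Submodule.map₂ (TensorProduct.mk K _ _) (degreeLT K m) (degreeLT K n) ≤
      (Submodule.map₂ (TensorProduct.mk K _ _) (degreeLT K (m + 1)) (degreeLT K (n + 1))).comap
        (LinearMap.mulLeft K (diagVar K)) from h hz
  refine Submodule.map₂_le.2 fun f hf g hg => ?_
  have : diagVar K * (f ⊗ₜ[K] g) = (X * f) ⊗ₜ g - f ⊗ₜ (X * g) := by
    simp [diagVar, sub_mul]
  simp only [Submodule.mem_comap, LinearMap.mulLeft_apply, TensorProduct.mk_apply, this]
  exact Submodule.sub_mem _ (Submodule.apply_mem_map₂ _ (hmul _ _ hf) (hmono _ hg))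
    (Submodule.apply_mem_map₂ _ (hmono _ hf) (hmul _ _ hg))

theorem diagVar_pow_mul_binom_mem (j p q : ℕ) :
    diagVar K ^ j * (binomPoly K p ⊗ₜ[K] binomPoly K q) ∈
      LinearMap.range (TensorProduct.mapIncl (degreeLT K (p + 1 + j)) (degreeLT K (q + 1 + j))) := by
  induction j with
  | zero =>
    refine ⟨⟨_, binomPoly_mem_degreeLT K p⟩ ⊗ₜ ⟨_, binomPoly_mem_degreeLT K q⟩, ?_⟩
    simp
  | succ j ih =>
    rw [pow_succ', mul_assoc]
    exact diagVar_mul_mem _ _ _ ih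

end Translation

/-! ### Decomposition of tensor products of Jordan cells -/

section ClebschGordan

variable {K : Type*} [Field K]

variable (K) in
/-- The translation `f(X) ↦ f(X + 1)` on the polynomials of degree less than `m`. -/
def taylorLT (m : ℕ) : Module.End K (degreeLT K m) := (Polynomial.taylorLinearEquiv (1 : K) m).toLinearMap

theorem coe_taylorLT (m : ℕ) (f : degreeLT K m) : (taylorLT K m f : K[X]) = taylor 1 (f : K[X]) := rfl

theorem taylorLT_sub_one_pow_binomPoly [CharZero K] (m p k : ℕ) (h : p < m) :
    (((taylorLT K m - 1) ^ k) ⟨binomPoly K p, degreeLT_mono h (binomPoly_mem_degreeLT K p)⟩ :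
      K[X]) = if k ≤ p then binomPoly K (p - k) else 0 := by
  induction k generalizing p with
  | zero => simp
  | succ k ih =>
    have hN : (taylorLT K m - 1) ⟨binomPoly K p, degreeLT_mono h (binomPoly_mem_degreeLT K p)⟩ =
        if hp : p = 0 then 0 else ⟨binomPoly K (p - 1),
          degreeLT_mono (by omega) (binomPoly_mem_degreeLT K (p - 1))⟩ := by
      rcases p with _ | p
      · ext1
        simp [coe_taylorLT, binomPoly_zero]
      · ext1
        simp [coe_taylorLT, taylor_binomPoly_succ]
    rw [pow_succ, Module.End.mul_apply, hN]
    split_ifs with h1 h2 h2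
    · omega
    · simp
    · rw [ih _ (by omega), if_pos (by omega), Nat.sub_sub, Nat.add_comm]
    · rw [ih _ (by omega), if_neg (by omega)]

theorem finrank_degreeLT (m : ℕ) : Module.finrank K (degreeLT K m) = m := by
  rw [(degreeLTEquiv K m).finrank_eq, Module.finrank_fin_fun]

instance (m : ℕ) : FiniteDimensional K (degreeLT K m) :=
  Module.Finite.equiv (degreeLTEquiv K m).symm

/-- The Jordan cell `J_m(c)` is similar to `c` times the translation on the polynomials of degree
less than `m`. -/
theorem exists_equiv_taylorLT [CharZero K] (m : ℕ) (hm : 1 ≤ m) (c : K) (hc : c ≠ 0) :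
    ∃ g : degreeLT K m ≃ₗ[K] (Fin m → K),
      ∀ x, g (c • taylorLT K m x) = (jordanCell K m c).mulVec (g x) := by
  have hpow : ∀ k : ℕ, (c • (taylorLT K m - 1)) ^ k = c ^ k • (taylorLT K m - 1) ^ k :=
    fun k => smul_pow _ _ _
  -- The binomial polynomial of top degree `m - 1` starts a single chain of full length `m`. With `N
  -- = c (τ - 1)`, the operator `c + N` is `c τ`, and the chain ends in `c ^ (m - 1)`, which is
  -- nonzero.
  let v : degreeLT K m :=
    ⟨binomPoly K (m - 1), degreeLT_mono (by omega) (binomPoly_mem_degreeLT K (m - 1))⟩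
  obtain ⟨g, hg⟩ := exists_equiv_of_chains (ι := Unit) c (c • (taylorLT K m - 1)) (fun _ => m)
    (fun _ => v)
    (fun _ => by
      rw [hpow, LinearMap.smul_apply]
      refine Subtype.ext ?_
      rw [Submodule.coe_smul, taylorLT_sub_one_pow_binomPoly _ _ _ (by omega),
        if_neg (by omega), smul_zero, Submodule.coe_zero])
    (by
      refine LinearIndependent.of_subsingleton () ?_
      rw [hpow, LinearMap.smul_apply]
      refine smul_ne_zero (pow_ne_zero _ hc) fun h => ?_
      have h' := congrArg (Subtype.val) h
      rw [taylorLT_sub_one_pow_binomPoly _ _ _ (by omega), if_pos le_rfl, Nat.sub_self,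
        binomPoly_zero] at h'
      exact one_ne_zero h')
    (by simp [finrank_degreeLT])
  refine ⟨g.trans (LinearEquiv.funUnique Unit K (Fin m → K)), fun x => ?_⟩
  have h := hg x ()
  have hx : c • x + (c • (taylorLT K m - 1)) x = c • taylorLT K m x := by
    simp [smul_sub]
  rw [hx] at h
  exact h

/-- For `a = m₁ + m₂` and `k = min m₁ m₂` the value is `min m₁ m₂ * max m₁ m₂ = m₁ * m₂`. The bound
on `k` keeps the natural subtractions from truncating. -/
theorem sum_chain_lengths (a k : ℕ) (h : 2 * k ≤ a + 1) :
    ∑ j ∈ Finset.range k, (a - 1 - 2 * j) = k * (a - k) := by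
  induction k with
  | zero => simp
  | succ k ih =>
    rw [Finset.sum_range_succ, ih (by omega)]
    obtain ⟨b, rfl⟩ : ∃ b, a = b + 2 * k + 1 := ⟨a - 2 * k - 1, by omega⟩
    rw [show b + 2 * k + 1 - k = b + k + 1 by omega, show b + 2 * k + 1 - 1 - 2 * k = b by omega,
      show b + 2 * k + 1 - (k + 1) = b + k by omega]
    ring

theorem summandSizes_eq_image (m₁ m₂ : ℕ) (hm₁ : 1 ≤ m₁) (hm₂ : 1 ≤ m₂) :
    summandSizes m₁ m₂ =
      (Finset.range (min m₁ m₂)).image fun j => m₁ + m₂ - 1 - 2 * j := by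
  ext s
  simp only [summandSizes, Finset.mem_filter, Finset.mem_Icc, Finset.mem_image, Finset.mem_range]
  simp only [Nat.ModEq]
  constructor
  · rintro ⟨⟨h1, h2⟩, h3⟩
    exact ⟨(m₁ + m₂ - 1 - s) / 2, by omega, by omega⟩
  · rintro ⟨j, hj, rfl⟩
    omega

theorem sum_summandSizes (m₁ m₂ : ℕ) (hm₁ : 1 ≤ m₁) (hm₂ : 1 ≤ m₂) :
    ∑ s : summandSizes m₁ m₂, (s : ℕ) = m₁ * m₂ := by
  rw [Finset.sum_coe_sort (summandSizes m₁ m₂) fun s => s, summandSizes_eq_image m₁ m₂ hm₁ hm₂,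
    Finset.sum_image, sum_chain_lengths _ _ (by omega)]
  · rcases le_total m₁ m₂ with h | h
    · simp [h]
    · simp [h, mul_comm]
  · intro i hi j hj h
    simp only [Finset.coe_range, Set.mem_Iio] at hi hj
    simp only at h
    omega

/-- The exponents of a chain of length `s`: it starts at `(X - Y)^j binom(X, p) binom(Y, q)`, which
has degree exactly at the bounds `m₁ - 1` in `X` and `m₂ - 1` in `Y`. -/
theorem exists_of_mem_summandSizes {m₁ m₂ : ℕ} (hm₁ : 1 ≤ m₁) (hm₂ : 1 ≤ m₂) {s : ℕ}
    (hs : s ∈ summandSizes m₁ m₂) :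
    ∃ p q j : ℕ, p + 1 + j = m₁ ∧ q + 1 + j = m₂ ∧ s = p + q + 1 := by
  rw [summandSizes_eq_image m₁ m₂ hm₁ hm₂] at hs
  simp only [Finset.mem_image, Finset.mem_range] at hs
  obtain ⟨j, hj, rfl⟩ := hs
  exact ⟨m₁ - 1 - j, m₂ - 1 - j, j, by omega, by omega, by omega⟩

/-- `J_m(c)` is the restriction of `c` times the translation along an embedding of `K^m` onto the
polynomials of degree less than `m`. -/
theorem exists_embedding_jordanCell [CharZero K] (m : ℕ) (hm : 1 ≤ m) (c : K) (hc : c ≠ 0) :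
    ∃ i : (Fin m → K) →ₗ[K] K[X], Function.Injective i ∧ LinearMap.range i = degreeLT K m ∧
      ∀ x, i ((jordanCell K m c).mulVecLin x) = c • taylor 1 (i x) := by
  obtain ⟨g, hg⟩ := exists_equiv_taylorLT m hm c hc
  refine ⟨(degreeLT K m).subtype ∘ₗ g.symm.toLinearMap,
    (Submodule.subtype_injective _).comp g.symm.injective, ?_, fun x => ?_⟩
  · rw [LinearMap.range_comp, LinearEquiv.range, Submodule.map_top, Submodule.range_subtype]
  · obtain ⟨y, rfl⟩ := g.surjective x
    have h : g.symm ((jordanCell K m c).mulVecLin (g y)) = c • taylorLT K m y := by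
      rw [LinearEquiv.symm_apply_eq, hg]
      rfl
    simp only [LinearMap.comp_apply, LinearEquiv.coe_coe, h, LinearEquiv.symm_apply_apply]
    rfl

/-- In characteristic zero, `J_{m₁}(c₁) ⊗ J_{m₂}(c₂)` is similar to the direct sum of the
`J_s(c₁ c₂)`. -/
theorem exists_equiv_jordanCell_tensor [CharZero K] (m₁ m₂ : ℕ) (hm₁ : 1 ≤ m₁) (hm₂ : 1 ≤ m₂)
    (c₁ c₂ : K) (hc₁ : c₁ ≠ 0) (hc₂ : c₂ ≠ 0) :
    ∃ g : (Fin m₁ → K) ⊗[K] (Fin m₂ → K) ≃ₗ[K] (∀ s : summandSizes m₁ m₂, Fin s → K),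
      ∀ x s, g (TensorProduct.map (jordanCell K m₁ c₁).mulVecLin (jordanCell K m₂ c₂).mulVecLin x) s
        = (jordanCell K s (c₁ * c₂)).mulVec (g x s) := by
  obtain ⟨i₁, hi₁, hr₁, hJ₁⟩ := exists_embedding_jordanCell m₁ hm₁ c₁ hc₁
  obtain ⟨i₂, hi₂, hr₂, hJ₂⟩ := exists_embedding_jordanCell m₂ hm₂ c₂ hc₂
  have hc : c₁ * c₂ ≠ 0 := mul_ne_zero hc₁ hc₂
  let T : Module.End K ((Fin m₁ → K) ⊗[K] (Fin m₂ → K)) :=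
    TensorProduct.map (jordanCell K m₁ c₁).mulVecLin (jordanCell K m₂ c₂).mulVecLin
  let N : Module.End K ((Fin m₁ → K) ⊗[K] (Fin m₂ → K)) := T - (c₁ * c₂) • 1
  -- All computations are transported to `K[X] ⊗ K[X]`, where multiplication by `X - Y` is defined;
  -- there `N` becomes `c₁ c₂` times the difference operator.
  let inc := TensorProduct.map i₁ i₂
  have hinj : Function.Injective inc := TensorProduct.map_injective_of_flat_flat _ _ hi₁ hi₂
  have hincT : ∀ x, inc (T x) = (c₁ * c₂) • diagTaylor K (inc x) := by
    intro x
    induction x with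
    | zero => simp
    | add x y hx hy => simp only [map_add, hx, hy, smul_add]
    | tmul x y =>
      simp only [T, inc, TensorProduct.map_tmul, hJ₁, hJ₂, diagTaylor_tmul,
        TensorProduct.smul_tmul_smul]
  have hincN : ∀ x, inc (N x) = (c₁ * c₂) • diagDiff K (inc x) := by
    intro x
    simp only [N, LinearMap.sub_apply, LinearMap.smul_apply, map_sub, map_smul,
      Module.End.one_apply, diagDiff_apply, hincT, smul_sub]
  have hincNk : ∀ (k : ℕ) x, inc ((N ^ k) x) = (c₁ * c₂) ^ k • (diagDiff K ^ k) (inc x) := by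
    intro k
    induction k with
    | zero => simp
    | succ k ih =>
      intro x
      rw [pow_succ, Module.End.mul_apply, ih, hincN, map_smul, smul_smul, ← pow_succ,
        pow_succ (diagDiff K), Module.End.mul_apply]
  choose p q j hj₁ hj₂ hs using fun s : summandSizes m₁ m₂ =>
    exists_of_mem_summandSizes hm₁ hm₂ s.2
  have hex : ∀ s, ∃ v, inc v = diagVar K ^ j s * (binomPoly K (p s) ⊗ₜ[K] binomPoly K (q s)) := by
    intro s
    have h := diagVar_pow_mul_binom_mem (K := K) (j s) (p s) (q s)
    rw [hj₁ s, hj₂ s, TensorProduct.range_mapIncl, ← hr₁, ← hr₂,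
      ← TensorProduct.range_map] at h
    exact h
  choose v hv using hex
  obtain ⟨g, hg⟩ := exists_equiv_of_chains (c₁ * c₂) N (fun s : summandSizes m₁ m₂ => (s : ℕ)) v
    (fun s => by
      refine hinj ?_
      rw [hincNk, hv, diagDiff_pow_mul, diagDiff_pow_binom_eq_zero _ _ _ (by have := hs s; omega),
        mul_zero, smul_zero, map_zero])
    (by
      refine LinearIndependent.of_comp inc ?_
      -- The chain of length `s` ends in this scalar times `(X - Y)^j`. The binomial coefficient is
      -- nonzero in `K` because the characteristic is zero.
      have hne : ∀ s : summandSizes m₁ m₂,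
          (c₁ * c₂) ^ ((s : ℕ) - 1) * (((s : ℕ) - 1).choose (p s) : K) ≠ 0 := fun s =>
        mul_ne_zero (pow_ne_zero _ hc)
          (Nat.cast_ne_zero.2 (Nat.choose_pos (by have := hs s; omega)).ne')
      have hjinj : Function.Injective j := fun s t h => by
        have := hs s; have := hs t; have := hj₁ s; have := hj₁ t; have := hj₂ s; have := hj₂ t
        exact Subtype.ext (by omega)
      have hli := (linearIndependent_diagVar_pow (K := K)).comp j hjinj
      have hli' := hli.units_smul fun s => Units.mk0 _ (hne s)
      convert hli' using 1
      funext s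
      simp only [Function.comp_apply, Pi.smul_apply', Units.smul_mk0]
      rw [hincNk, hv, diagDiff_pow_mul, diagDiff_pow_binom _ _ _ (by have := hs s; omega),
        mul_smul_comm, mul_one, smul_smul])
    (by rw [sum_summandSizes m₁ m₂ hm₁ hm₂, Module.finrank_tensorProduct, Module.finrank_fin_fun,
      Module.finrank_fin_fun])
  refine ⟨g, fun x s => ?_⟩
  rw [← hg]
  refine congrArg (fun z => g z s) ?_
  simp [T, N]

end ClebschGordan

/-! ### Bimodules as cyclic representations -/

section Coordinates

variable {K : Type*} [Field K] {n : ℕ} [NeZero n] {V : Type*} [AddCommGroup V] [Module K V]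

/-- The projection to the vertices `j|*` on a representation with value `V` at all vertices
`i|i` (first component) and `(i+1)|i` (second component). -/
def cycLeftE (j : ZMod n) : Module.End K ((ZMod n → V) × (ZMod n → V)) where
  toFun z := (fun i => if i = j then z.1 i else 0, fun i => if i + 1 = j then z.2 i else 0)
  map_add' x y := by ext <;> simp <;> split_ifs <;> simp
  map_smul' c x := by ext <;> simp

/-- The identity from the vertex `j|j` to the vertex `(j+1)|j`. -/
def cycLeftA (j : ZMod n) : Module.End K ((ZMod n → V) × (ZMod n → V)) where
  toFun z := (0, fun i => if i = j then z.1 i else 0)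
  map_add' x y := by ext <;> simp <;> split_ifs <;> simp
  map_smul' c x := by ext <;> simp

/-- The projection to the vertices `*|j`. -/
def cycRightE (j : ZMod n) : Module.End K ((ZMod n → V) × (ZMod n → V)) where
  toFun z := (fun i => if i = j then z.1 i else 0, fun i => if i = j then z.2 i else 0)
  map_add' x y := by ext <;> simp <;> split_ifs <;> simp
  map_smul' c x := by ext <;> simp

/-- The map `P j` from the vertex `(j+1)|(j+1)` to the vertex `(j+1)|j`. -/
def cycRightA (P : ZMod n → Module.End K V) (j : ZMod n) :
    Module.End K ((ZMod n → V) × (ZMod n → V)) where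
  toFun z := (0, fun i => if i = j then P i (z.1 (i + 1)) else 0)
  map_add' x y := by ext <;> simp <;> split_ifs <;> simp
  map_smul' c x := by ext <;> simp

/-- The linear bijection `e` identifies the bimodule `Z` with the cyclic representation with value
`V` at all vertices, identities for the left arrows and the maps `P i` for the right arrows, the
right action being twisted by the rotation by `d`. -/
structure IsCoordinates (Z : Bimodule K (Q K n)) (d : ZMod n) (P : ZMod n → Module.End K V)
    (e : Z.carrier ≃ₗ[K] (ZMod n → V) × (ZMod n → V)) : Prop where
  left_ε : ∀ j z, e (Z.left (ε K n j) z) = cycLeftE (K := K) j (e z)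
  left_α : ∀ j z, e (Z.left (α K n j) z) = cycLeftA (K := K) j (e z)
  right_ε : ∀ j z, e (Z.right (MulOpposite.op (ε K n j)) z) = cycRightE (K := K) (j + d) (e z)
  right_α : ∀ j z, e (Z.right (MulOpposite.op (α K n j)) z) = cycRightA P (j + d) (e z)

theorem Bimodule.isIso_of_generators (X Y : Bimodule K (Q K n)) (e : X.carrier ≃ₗ[K] Y.carrier)
    (lε : ∀ j x, e (X.left (ε K n j) x) = Y.left (ε K n j) (e x))
    (lα : ∀ j x, e (X.left (α K n j) x) = Y.left (α K n j) (e x))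
    (rε : ∀ j x, e (X.right (MulOpposite.op (ε K n j)) x) =
      Y.right (MulOpposite.op (ε K n j)) (e x))
    (rα : ∀ j x, e (X.right (MulOpposite.op (α K n j)) x) =
      Y.right (MulOpposite.op (α K n j)) (e x)) : X.IsIso Y := by
  refine ⟨e, fun a => ?_, fun a => ?_⟩
  · induction a using Q.induction with
    | hE i => exact lε i
    | hA i => exact lα i
    | hs c => intro x; simp [AlgHom.commutes, Module.algebraMap_end_apply]
    | hadd a b ha hb => intro x; simp [ha, hb]
    | hmul a b ha hb => intro x; simp [ha, hb]
  · induction a using Q.induction with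
    | hE i => exact rε i
    | hA i => exact rα i
    | hs c =>
      intro x
      have hX : X.right (MulOpposite.op (algebraMap K (Q K n) c)) = algebraMap K _ c :=
        X.right.commutes c
      have hY : Y.right (MulOpposite.op (algebraMap K (Q K n) c)) = algebraMap K _ c :=
        Y.right.commutes c
      simp [hX, hY, Module.algebraMap_end_apply]
    | hadd a b ha hb => intro x; simp [ha, hb]
    | hmul a b ha hb => intro x; simp [ha, hb]

/-- The same `g i` is used on `T_i` and on `S_i`, so the identities on the left arrows are preserved
automatically and only the right arrows impose a condition. -/
theorem IsCoordinates.isIso {V' : Type*} [AddCommGroup V'] [Module K V']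
    {Z Z' : Bimodule K (Q K n)} {d : ZMod n} {P : ZMod n → Module.End K V}
    {P' : ZMod n → Module.End K V'}
    {e : Z.carrier ≃ₗ[K] (ZMod n → V) × (ZMod n → V)}
    {e' : Z'.carrier ≃ₗ[K] (ZMod n → V') × (ZMod n → V')}
    (h : IsCoordinates Z d P e) (h' : IsCoordinates Z' d P' e')
    (g : ZMod n → V ≃ₗ[K] V') (hg : ∀ i v, g i (P i v) = P' i (g (i + 1) v)) : Z.IsIso Z' := by
  let G : ((ZMod n → V) × (ZMod n → V)) ≃ₗ[K] ((ZMod n → V') × (ZMod n → V')) :=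
    (LinearEquiv.piCongrRight g).prodCongr (LinearEquiv.piCongrRight g)
  have hG : ∀ z, G z = (fun i => g i (z.1 i), fun i => g i (z.2 i)) := fun z => rfl
  refine Bimodule.isIso_of_generators Z Z' (e.trans (G.trans e'.symm)) ?_ ?_ ?_ ?_
  · intro j x
    simp only [LinearEquiv.trans_apply]
    rw [LinearEquiv.symm_apply_eq, h'.left_ε, LinearEquiv.apply_symm_apply, h.left_ε]
    refine Prod.ext (funext fun i => ?_) (funext fun i => ?_) <;>
      simp [hG, cycLeftE] <;> split_ifs <;> simp
  · intro j x
    simp only [LinearEquiv.trans_apply]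
    rw [LinearEquiv.symm_apply_eq, h'.left_α, LinearEquiv.apply_symm_apply, h.left_α]
    refine Prod.ext (funext fun i => ?_) (funext fun i => ?_) <;>
      simp [hG, cycLeftA] <;> split_ifs <;> simp
  · intro j x
    simp only [LinearEquiv.trans_apply]
    rw [LinearEquiv.symm_apply_eq, h'.right_ε, LinearEquiv.apply_symm_apply, h.right_ε]
    refine Prod.ext (funext fun i => ?_) (funext fun i => ?_) <;>
      simp [hG, cycRightE] <;> split_ifs <;> simp
  · intro j x
    simp only [LinearEquiv.trans_apply]
    rw [LinearEquiv.symm_apply_eq, h'.right_α, LinearEquiv.apply_symm_apply, h.right_α]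
    refine Prod.ext (funext fun i => ?_) (funext fun i => ?_) <;>
      simp [hG, cycRightA] <;> split_ifs <;> simp [hg]

end Coordinates

/-! ### Coordinates on band bimodules and on direct sums -/

section Band

variable {K : Type*} [Field K] {n : ℕ}

/-- The right action of the arrows on `B(1, m, c)`: the Jordan cell at `1`, identities elsewhere. -/
def holonomy (m : ℕ) (c : K) (i : ZMod n) : Module.End K (Fin m → K) :=
  if i = 1 then (jordanCell K m c).mulVecLin else 1

theorem rightA_eq_cycRightA (m : ℕ) (c : K) (j : ZMod n) :
    rightA m c j = cycRightA (holonomy m c) j := by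
  refine LinearMap.ext fun x => Prod.ext rfl (funext fun i => ?_)
  simp only [rightA, cycRightA, LinearMap.coe_mk, AddHom.coe_mk, holonomy]
  by_cases h1 : i = j
  · subst h1
    by_cases h2 : i = 1 <;> simp [h2]
  · simp [h1]

theorem leftA_eq_cycLeftA (m : ℕ) (j : ZMod n) : leftA K m j = cycLeftA (K := K) j := by
  refine LinearMap.ext fun x => Prod.ext rfl (funext fun i => ?_)
  simp only [leftA, cycLeftA, LinearMap.coe_mk, AddHom.coe_mk]
  split_ifs with h1
  · rw [h1]
  · rfl

variable [NeZero n]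

theorem θ_pow_ε (k : ℕ) (i : ZMod n) : (θ K n ^ k) (ε K n i) = ε K n (i + k) := by
  induction k generalizing i with
  | zero => simp
  | succ k ih =>
    have h : θ K n (ε K n i) = ε K n (i + 1) := Q.lift_ε ..
    rw [pow_succ, AlgHom.mul_apply, h, ih]
    push_cast
    rw [add_assoc, add_comm 1]

theorem θ_pow_α (k : ℕ) (i : ZMod n) : (θ K n ^ k) (α K n i) = α K n (i + k) := by
  induction k generalizing i with
  | zero => simp
  | succ k ih =>
    have h : θ K n (α K n i) = α K n (i + 1) := Q.lift_α ..
    rw [pow_succ, AlgHom.mul_apply, h, ih]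
    push_cast
    rw [add_assoc, add_comm 1]

theorem isCoordinates_band (k : ZMod n) (m : ℕ) (c : K) :
    IsCoordinates (band n k m c) (k - 1) (holonomy m c)
      (LinearEquiv.refl K (BandSpace K n m)) where
  left_ε j z := LinearMap.congr_fun (Q.lift_ε .. : bandLeft (K := K) n m (ε K n j) = leftE K m j) z
  left_α j z := by
    rw [← leftA_eq_cycLeftA]
    exact LinearMap.congr_fun (Q.lift_α .. : bandLeft (K := K) n m (α K n j) = leftA K m j) z
  right_ε j z := by
    have h : (band n k m c).right (MulOpposite.op (ε K n j)) =
        bandRight n m c (MulOpposite.op ((θ K n ^ (k - 1).val) (ε K n j))) := rfl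
    have h' : ∀ j, bandRight n m c (MulOpposite.op (ε K n j)) = rightE K m j := fun j =>
      congrArg MulOpposite.unop (Q.lift_ε ..)
    rw [h, θ_pow_ε, h', ZMod.natCast_zmod_val]
    rfl
  right_α j z := by
    have h : (band n k m c).right (MulOpposite.op (α K n j)) =
        bandRight n m c (MulOpposite.op ((θ K n ^ (k - 1).val) (α K n j))) := rfl
    have h' : ∀ j, bandRight n m c (MulOpposite.op (α K n j)) = rightA m c j := fun j =>
      congrArg MulOpposite.unop (Q.lift_α ..)
    rw [h, θ_pow_α, h', ZMod.natCast_zmod_val, rightA_eq_cycRightA]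
    rfl

/-- Exchanging a finite product of bimodules with the vertices. -/
def piSwap {ι : Type} (V : ι → Type*) [∀ s, AddCommGroup (V s)] [∀ s, Module K (V s)] :
    (∀ s, (ZMod n → V s) × (ZMod n → V s)) ≃ₗ[K]
      (ZMod n → ∀ s, V s) × (ZMod n → ∀ s, V s) where
  toFun z := (fun i s => (z s).1 i, fun i s => (z s).2 i)
  invFun z s := (fun i => z.1 i s, fun i => z.2 i s)
  map_add' _ _ := rfl
  map_smul' _ _ := rfl
  left_inv _ := rfl
  right_inv _ := rfl

theorem IsCoordinates.directSum {ι : Type} [Finite ι] {V : ι → Type*} [∀ s, AddCommGroup (V s)]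
    [∀ s, Module K (V s)] {d : ZMod n} {X : ι → Bimodule K (Q K n)}
    {P : ∀ s, ZMod n → Module.End K (V s)}
    {e : ∀ s, (X s).carrier ≃ₗ[K] (ZMod n → V s) × (ZMod n → V s)}
    (h : ∀ s, IsCoordinates (X s) d (P s) (e s)) :
    IsCoordinates (Bimodule.directSum X) d
      (fun i => LinearMap.pi fun s => P s i ∘ₗ LinearMap.proj s)
      ((LinearEquiv.piCongrRight e).trans (piSwap V)) where
  left_ε j z := by
    have hz : (LinearEquiv.piCongrRight e) ((Bimodule.directSum X).left (ε K n j) z) =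
        fun s => cycLeftE (K := K) j (e s (z s)) := funext fun s => (h s).left_ε j (z s)
    refine (congrArg (piSwap (K := K) (n := n) V) hz).trans ?_
    change _ = cycLeftE (K := K) j (piSwap (K := K) V fun s => e s (z s))
    refine Prod.ext (funext fun i => funext fun s => ?_) (funext fun i => funext fun s => ?_) <;>
      simp [piSwap, cycLeftE] <;> split_ifs <;> rfl
  left_α j z := by
    have hz : (LinearEquiv.piCongrRight e) ((Bimodule.directSum X).left (α K n j) z) =
        fun s => cycLeftA (K := K) j (e s (z s)) := funext fun s => (h s).left_α j (z s)
    refine (congrArg (piSwap (K := K) (n := n) V) hz).trans ?_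
    change _ = cycLeftA (K := K) j (piSwap (K := K) V fun s => e s (z s))
    refine Prod.ext (funext fun i => funext fun s => ?_) (funext fun i => funext fun s => ?_) <;>
      simp [piSwap, cycLeftA] <;> split_ifs <;> rfl
  right_ε j z := by
    have hz : (LinearEquiv.piCongrRight e)
        ((Bimodule.directSum X).right (MulOpposite.op (ε K n j)) z) =
        fun s => cycRightE (K := K) (j + d) (e s (z s)) :=
      funext fun s => (h s).right_ε j (z s)
    refine (congrArg (piSwap (K := K) (n := n) V) hz).trans ?_
    change _ = cycRightE (K := K) (j + d) (piSwap (K := K) V fun s => e s (z s))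
    refine Prod.ext (funext fun i => funext fun s => ?_) (funext fun i => funext fun s => ?_) <;>
      simp [piSwap, cycRightE] <;> split_ifs <;> rfl
  right_α j z := by
    have hz : (LinearEquiv.piCongrRight e)
        ((Bimodule.directSum X).right (MulOpposite.op (α K n j)) z) =
        fun s => cycRightA (P s) (j + d) (e s (z s)) :=
      funext fun s => (h s).right_α j (z s)
    refine (congrArg (piSwap (K := K) (n := n) V) hz).trans ?_
    change _ = cycRightA _ (j + d) (piSwap (K := K) V fun s => e s (z s))
    refine Prod.ext (funext fun i => funext fun s => ?_) (funext fun i => funext fun s => ?_) <;>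
      simp [piSwap, cycRightA] <;> split_ifs <;> rfl

end Band

/-! ### Tensor products over `Q_n` in coordinates -/

section Tensor

variable {K : Type*} [Field K] {n : ℕ}
  {V W : Type*} [AddCommGroup V] [Module K V] [AddCommGroup W] [Module K W]

/-- On cyclic representations, the linear map inducing the isomorphism from the tensor product over
the algebra to a cyclic representation. -/
def cycTensor (d : ZMod n) (P : ZMod n → Module.End K V) :
    ((ZMod n → V) × (ZMod n → V)) ⊗[K] ((ZMod n → W) × (ZMod n → W)) →ₗ[K]
      (ZMod n → V ⊗[K] W) × (ZMod n → V ⊗[K] W) :=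
  let v (i : ZMod n) : (ZMod n → V) →ₗ[K] V := LinearMap.proj i
  let w (i : ZMod n) : (ZMod n → W) →ₗ[K] W := LinearMap.proj i
  LinearMap.prod
    (LinearMap.pi fun i => TensorProduct.map
      (v i ∘ₗ LinearMap.fst K _ _) (w (i - d) ∘ₗ LinearMap.fst K _ _))
    -- The block `i` of the left factor meets the block `i - d` of the right one because of the
    -- twist. The second summand encodes `x ⊗ α t = x α ⊗ t` for `S_{i-d} = α_{i-d} T_{i-d}`.
    -- Tensors of two `S`-entries go to zero, since arrows act as zero on `S`.
    (LinearMap.pi fun i =>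
      TensorProduct.map (v i ∘ₗ LinearMap.snd K _ _) (w (i - d) ∘ₗ LinearMap.fst K _ _) +
      TensorProduct.map (P i ∘ₗ v (i + 1) ∘ₗ LinearMap.fst K _ _)
        (w (i - d) ∘ₗ LinearMap.snd K _ _))

theorem cycTensor_tmul (d : ZMod n) (P : ZMod n → Module.End K V)
    (x : (ZMod n → V) × (ZMod n → V)) (y : (ZMod n → W) × (ZMod n → W)) :
    cycTensor d P (x ⊗ₜ[K] y) = (fun i => x.1 i ⊗ₜ y.1 (i - d),
      fun i => x.2 i ⊗ₜ y.1 (i - d) + P i (x.1 (i + 1)) ⊗ₜ y.2 (i - d)) := rfl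

theorem cycTensor_balanced_ε (d : ZMod n) (P : ZMod n → Module.End K V) (j : ZMod n)
    (x : (ZMod n → V) × (ZMod n → V)) (y : (ZMod n → W) × (ZMod n → W)) :
    cycTensor d P (cycRightE (K := K) (j + d) x ⊗ₜ[K] y) =
      cycTensor d P (x ⊗ₜ[K] cycLeftE (K := K) j y) := by
  have h1 : ∀ i, i - d = j ↔ i = j + d := fun i => sub_eq_iff_eq_add
  have h2 : ∀ i, i - d + 1 = j ↔ i + 1 = j + d := fun i => by rw [← h1, sub_add_eq_add_sub]
  simp only [cycTensor_tmul, cycRightE, cycLeftE, LinearMap.coe_mk, AddHom.coe_mk, h1, h2]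
  refine Prod.ext (funext fun i => ?_) (funext fun i => ?_) <;> simp only <;> split_ifs <;> simp

theorem cycTensor_balanced_α (d : ZMod n) (P : ZMod n → Module.End K V) (j : ZMod n)
    (x : (ZMod n → V) × (ZMod n → V)) (y : (ZMod n → W) × (ZMod n → W)) :
    cycTensor d P (cycRightA P (j + d) x ⊗ₜ[K] y) =
      cycTensor d P (x ⊗ₜ[K] cycLeftA (K := K) j y) := by
  have h1 : ∀ i, i - d = j ↔ i = j + d := fun i => sub_eq_iff_eq_add
  simp only [cycTensor_tmul, cycRightA, cycLeftA, LinearMap.coe_mk, AddHom.coe_mk, h1]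
  refine Prod.ext (funext fun i => by simp) (funext fun i => ?_)
  simp only [Pi.zero_apply]
  split_ifs <;> simp

theorem cycTensor_leftE (d : ZMod n) (P : ZMod n → Module.End K V) (j : ZMod n)
    (x : (ZMod n → V) × (ZMod n → V)) (y : (ZMod n → W) × (ZMod n → W)) :
    cycTensor d P (cycLeftE (K := K) j x ⊗ₜ[K] y) =
      cycLeftE (K := K) j (cycTensor d P (x ⊗ₜ[K] y)) := by
  simp only [cycTensor_tmul, cycLeftE, LinearMap.coe_mk, AddHom.coe_mk]
  refine Prod.ext (funext fun i => ?_) (funext fun i => ?_) <;> simp only <;> split_ifs <;> simp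

theorem cycTensor_leftA (d : ZMod n) (P : ZMod n → Module.End K V) (j : ZMod n)
    (x : (ZMod n → V) × (ZMod n → V)) (y : (ZMod n → W) × (ZMod n → W)) :
    cycTensor d P (cycLeftA (K := K) j x ⊗ₜ[K] y) =
      cycLeftA (K := K) j (cycTensor d P (x ⊗ₜ[K] y)) := by
  simp only [cycTensor_tmul, cycLeftA, LinearMap.coe_mk, AddHom.coe_mk]
  refine Prod.ext (funext fun i => by simp) (funext fun i => ?_)
  simp only [Pi.zero_apply]
  split_ifs <;> simp

theorem cycTensor_rightE (d d' : ZMod n) (P : ZMod n → Module.End K V) (j : ZMod n)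
    (x : (ZMod n → V) × (ZMod n → V)) (y : (ZMod n → W) × (ZMod n → W)) :
    cycTensor d P (x ⊗ₜ[K] cycRightE (K := K) (j + d') y) =
      cycRightE (K := K) (j + (d + d')) (cycTensor d P (x ⊗ₜ[K] y)) := by
  have h1 : ∀ i, i - d = j + d' ↔ i = j + (d + d') := fun i => by
    rw [sub_eq_iff_eq_add, add_assoc, add_comm d']
  simp only [cycTensor_tmul, cycRightE, LinearMap.coe_mk, AddHom.coe_mk, h1]
  refine Prod.ext (funext fun i => ?_) (funext fun i => ?_) <;> simp only <;> split_ifs <;> simp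

theorem cycTensor_rightA (d d' : ZMod n) (P : ZMod n → Module.End K V)
    (R : ZMod n → Module.End K W) (j : ZMod n)
    (x : (ZMod n → V) × (ZMod n → V)) (y : (ZMod n → W) × (ZMod n → W)) :
    cycTensor d P (x ⊗ₜ[K] cycRightA R (j + d') y) =
      cycRightA (fun i => TensorProduct.map (P i) (R (i - d))) (j + (d + d'))
        (cycTensor d P (x ⊗ₜ[K] y)) := by
  have h1 : ∀ i, i - d = j + d' ↔ i = j + (d + d') := fun i => by
    rw [sub_eq_iff_eq_add, add_assoc, add_comm d']
  have h2 : ∀ i, i - d + 1 = i + 1 - d := fun i => sub_add_eq_add_sub _ _ _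
  simp only [cycTensor_tmul, cycRightA, LinearMap.coe_mk, AddHom.coe_mk, h1, h2]
  refine Prod.ext (funext fun i => by simp) (funext fun i => ?_)
  simp only [Pi.zero_apply]
  split_ifs <;> simp

theorem single_tmul_single (i : ZMod n) (d : ZMod n) (v : V) (w : W) (l : ZMod n) :
    (Pi.single i v : ZMod n → V) l ⊗ₜ[K] (Pi.single (i - d) w : ZMod n → W) (l - d) =
      (Pi.single i (v ⊗ₜ[K] w) : ZMod n → V ⊗[K] W) l := by
  by_cases h : l = i
  · subst h; simp
  · simp [h]

variable [NeZero n]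

/-- The section of `cycTensor` that uses the summands at the vertices `i|i` of the right factor
only. -/
def cycTensorSection (d : ZMod n) :
    (ZMod n → V ⊗[K] W) × (ZMod n → V ⊗[K] W) →ₗ[K]
      ((ZMod n → V) × (ZMod n → V)) ⊗[K] ((ZMod n → W) × (ZMod n → W)) :=
  LinearMap.coprod
    (LinearMap.lsum K _ K fun i => TensorProduct.map
      (LinearMap.inl K _ _ ∘ₗ LinearMap.single K (fun _ : ZMod n => V) i)
      (LinearMap.inl K _ _ ∘ₗ LinearMap.single K (fun _ : ZMod n => W) (i - d)))
    (LinearMap.lsum K _ K fun i => TensorProduct.map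
      (LinearMap.inr K _ _ ∘ₗ LinearMap.single K (fun _ : ZMod n => V) i)
      (LinearMap.inl K _ _ ∘ₗ LinearMap.single K (fun _ : ZMod n => W) (i - d)))

theorem cycTensorSection_inl (d i : ZMod n) (v : V) (w : W) :
    cycTensorSection (K := K) d (Pi.single i (v ⊗ₜ[K] w), 0) =
      (Pi.single i v, 0) ⊗ₜ (Pi.single (i - d) w, 0) := by
  simp only [cycTensorSection, LinearMap.coprod_apply, LinearMap.lsum_apply, LinearMap.sum_apply,
    LinearMap.comp_apply, LinearMap.proj_apply, map_zero, add_zero]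
  rw [Finset.sum_eq_single i] <;> simp +contextual

theorem cycTensorSection_inr (d i : ZMod n) (v : V) (w : W) :
    cycTensorSection (K := K) d (0, Pi.single i (v ⊗ₜ[K] w)) =
      (0, Pi.single i v) ⊗ₜ (Pi.single (i - d) w, 0) := by
  simp only [cycTensorSection, LinearMap.coprod_apply, LinearMap.lsum_apply, LinearMap.sum_apply,
    LinearMap.comp_apply, LinearMap.proj_apply, map_zero, zero_add]
  rw [Finset.sum_eq_single i] <;> simp +contextual

theorem cycTensor_comp_section (d : ZMod n) (P : ZMod n → Module.End K V) :
    cycTensor d P ∘ₗ cycTensorSection (K := K) (V := V) (W := W) d = LinearMap.id := by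
  refine LinearMap.prod_ext (LinearMap.pi_ext' fun i => TensorProduct.ext' fun v w => ?_)
    (LinearMap.pi_ext' fun i => TensorProduct.ext' fun v w => ?_)
  · simp only [LinearMap.comp_apply, LinearMap.inl_apply, LinearMap.coe_single, LinearMap.id_apply]
    rw [cycTensorSection_inl, cycTensor_tmul]
    refine Prod.ext (funext fun l => single_tmul_single i d v w l) (funext fun l => ?_)
    simp
  · simp only [LinearMap.comp_apply, LinearMap.inr_apply, LinearMap.coe_single, LinearMap.id_apply]
    rw [cycTensorSection_inr, cycTensor_tmul]
    refine Prod.ext (funext fun l => ?_) (funext fun l => ?_)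
    · simp
    · simpa using single_tmul_single i d v w l

theorem Bimodule.mk_right_tmul {A : Type*} [Ring A] [Algebra K A] (X Y : Bimodule K A) (a : A)
    (x : X.carrier) (y : Y.carrier) :
    (balanced X Y).mkQ (X.right (MulOpposite.op a) x ⊗ₜ[K] y) =
      (balanced X Y).mkQ (x ⊗ₜ[K] Y.left a y) :=
  (Submodule.Quotient.eq _).2 (Submodule.subset_span ⟨x, a, y, rfl⟩)

/-- Balancedness passes to sums and products of algebra elements, so it suffices to check it on
generators. -/
theorem Bimodule.balanced_le_ker {U : Type*} [AddCommGroup U] [Module K U]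
    (X Y : Bimodule K (Q K n)) (f : X.carrier ⊗[K] Y.carrier →ₗ[K] U)
    (hε : ∀ j x y, f (X.right (MulOpposite.op (ε K n j)) x ⊗ₜ y) = f (x ⊗ₜ Y.left (ε K n j) y))
    (hα : ∀ j x y, f (X.right (MulOpposite.op (α K n j)) x ⊗ₜ y) = f (x ⊗ₜ Y.left (α K n j) y)) :
    balanced X Y ≤ LinearMap.ker f := by
  refine Submodule.span_le.2 ?_
  rintro _ ⟨x, a, y, rfl⟩
  rw [SetLike.mem_coe, LinearMap.mem_ker, map_sub, sub_eq_zero]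
  induction a using Q.induction generalizing x y with
  | hE i => exact hε i x y
  | hA i => exact hα i x y
  | hs c =>
    have hX : X.right (MulOpposite.op (algebraMap K (Q K n) c)) = algebraMap K _ c :=
      X.right.commutes c
    simp [hX, Module.algebraMap_end_apply, TensorProduct.smul_tmul']
  | hadd a b ha hb => simp [TensorProduct.add_tmul, TensorProduct.tmul_add, ha, hb]
  | hmul a b ha hb => simp [ha, hb]

variable {X Y : Bimodule K (Q K n)} {d d' : ZMod n} {P : ZMod n → Module.End K V}
  {R : ZMod n → Module.End K W} {e : X.carrier ≃ₗ[K] (ZMod n → V) × (ZMod n → V)}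
  {e' : Y.carrier ≃ₗ[K] (ZMod n → W) × (ZMod n → W)}

/-- The map on `X ⊗_A Y` induced by `cycTensor`. -/
def IsCoordinates.tensorMap (h : IsCoordinates X d P e) (h' : IsCoordinates Y d' R e') :
    (X.carrier ⊗[K] Y.carrier ⧸ Bimodule.balanced X Y) →ₗ[K]
      (ZMod n → V ⊗[K] W) × (ZMod n → V ⊗[K] W) :=
  (Bimodule.balanced X Y).liftQ (cycTensor d P ∘ₗ TensorProduct.map e.toLinearMap e'.toLinearMap)
    (Bimodule.balanced_le_ker X Y _
      (fun j x y => by simp [h.right_ε, h'.left_ε, cycTensor_balanced_ε])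
      (fun j x y => by simp [h.right_α, h'.left_α, cycTensor_balanced_α]))

theorem IsCoordinates.tensorMap_mk (h : IsCoordinates X d P e) (h' : IsCoordinates Y d' R e')
    (x : X.carrier) (y : Y.carrier) :
    h.tensorMap h' ((Bimodule.balanced X Y).mkQ (x ⊗ₜ y)) = cycTensor d P (e x ⊗ₜ e' y) := rfl

/-- The inverse of `tensorMap`. -/
def IsCoordinates.tensorInv (_ : IsCoordinates X d P e) (_ : IsCoordinates Y d' R e') :
    (ZMod n → V ⊗[K] W) × (ZMod n → V ⊗[K] W) →ₗ[K]
      (X.carrier ⊗[K] Y.carrier ⧸ Bimodule.balanced X Y) :=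
  (Bimodule.balanced X Y).mkQ ∘ₗ
    TensorProduct.map e.symm.toLinearMap e'.symm.toLinearMap ∘ₗ cycTensorSection d

theorem IsCoordinates.tensorMap_tensorInv (h : IsCoordinates X d P e)
    (h' : IsCoordinates Y d' R e') (z) : h.tensorMap h' (h.tensorInv h' z) = z := by
  have h1 : ∀ t : ((ZMod n → V) × (ZMod n → V)) ⊗[K] ((ZMod n → W) × (ZMod n → W)),
      h.tensorMap h' ((Bimodule.balanced X Y).mkQ
        (TensorProduct.map e.symm.toLinearMap e'.symm.toLinearMap t)) = cycTensor d P t := by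
    intro t
    induction t with
    | zero => simp
    | add x y hx hy => simp only [map_add, hx, hy]
    | tmul x y =>
      rw [TensorProduct.map_tmul, tensorMap_mk]
      simp
  exact (h1 _).trans (LinearMap.congr_fun (cycTensor_comp_section d P) z)

/-- A right entry in `S_l` is `α_l` times one in `T_l`, and `α_l` can be moved to the left factor. A
right entry in `T_l` is fixed by `ε_l`, and moving `ε_l` across cuts the left entry down to its
components at index `l + d`. What remains is in the image of the section. -/
theorem IsCoordinates.tensorInv_surjective (h : IsCoordinates X d P e)
    (h' : IsCoordinates Y d' R e') : Function.Surjective (h.tensorInv h') := by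
  rw [← LinearMap.range_eq_top, eq_top_iff]
  have hT : ∀ (x : X.carrier) (l : ZMod n) (w : W),
      (Bimodule.balanced X Y).mkQ (x ⊗ₜ e'.symm (Pi.single l w, 0)) ∈
        LinearMap.range (h.tensorInv h') := by
    intro x l w
    have hy : e'.symm (Pi.single l w, 0) = Y.left (ε K n l) (e'.symm (Pi.single l w, 0)) := by
      rw [LinearEquiv.symm_apply_eq, h'.left_ε, LinearEquiv.apply_symm_apply]
      refine Prod.ext (funext fun i => ?_) (funext fun i => ?_)
      · by_cases hi : i = l <;> simp [cycLeftE, hi]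
      · simp [cycLeftE]
    have hx : X.right (MulOpposite.op (ε K n l)) x =
        e.symm (Pi.single (l + d) ((e x).1 (l + d)), 0) +
          e.symm (0, Pi.single (l + d) ((e x).2 (l + d))) := by
      rw [← map_add, LinearEquiv.eq_symm_apply, h.right_ε]
      refine Prod.ext (funext fun i => ?_) (funext fun i => ?_) <;>
        by_cases hi : i = l + d <;> simp [cycRightE, hi]
    rw [hy, ← Bimodule.mk_right_tmul, hx, TensorProduct.add_tmul, map_add]
    refine Submodule.add_mem _
      ⟨(Pi.single (l + d) ((e x).1 (l + d) ⊗ₜ w), 0), ?_⟩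
      ⟨(0, Pi.single (l + d) ((e x).2 (l + d) ⊗ₜ w)), ?_⟩
    · simp [tensorInv, cycTensorSection_inl]
    · simp [tensorInv, cycTensorSection_inr]
  have hS : ∀ (x : X.carrier) (l : ZMod n) (w : W),
      (Bimodule.balanced X Y).mkQ (x ⊗ₜ e'.symm (0, Pi.single l w)) ∈
        LinearMap.range (h.tensorInv h') := by
    intro x l w
    have hy : e'.symm (0, Pi.single l w) = Y.left (α K n l) (e'.symm (Pi.single l w, 0)) := by
      rw [LinearEquiv.symm_apply_eq, h'.left_α, LinearEquiv.apply_symm_apply]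
      refine Prod.ext (funext fun i => ?_) (funext fun i => ?_)
      · simp [cycLeftA]
      · by_cases hi : i = l <;> simp [cycLeftA, hi]
    rw [hy, ← Bimodule.mk_right_tmul]
    exact hT _ l w
  rintro z -
  obtain ⟨t, rfl⟩ := Submodule.mkQ_surjective _ z
  induction t with
  | zero => simp
  | add x y hx hy => rw [map_add]; exact Submodule.add_mem _ hx hy
  | tmul x y =>
    have hy : y = ∑ l, (e'.symm (Pi.single l ((e' y).1 l), 0) +
        e'.symm (0, Pi.single l ((e' y).2 l))) := by
      rw [← e'.injective.eq_iff, map_sum]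
      simp only [map_add, LinearEquiv.apply_symm_apply]
      refine Prod.ext (funext fun i => ?_) (funext fun i => ?_) <;>
        simp [Prod.fst_sum, Prod.snd_sum, Finset.sum_apply]
    rw [hy, TensorProduct.tmul_sum, map_sum]
    refine Submodule.sum_mem _ fun l _ => ?_
    rw [TensorProduct.tmul_add, map_add]
    exact Submodule.add_mem _ (hT _ _ _) (hS _ _ _)

/-- The coordinates on `X ⊗_A Y`. -/
def IsCoordinates.tensorEquiv (h : IsCoordinates X d P e) (h' : IsCoordinates Y d' R e') :
    (Bimodule.tensor X Y).carrier ≃ₗ[K] (ZMod n → V ⊗[K] W) × (ZMod n → V ⊗[K] W) :=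
  LinearEquiv.ofLinearMap (h.tensorMap h') (h.tensorInv h')
    (LinearMap.ext (h.tensorMap_tensorInv h'))
    (LinearMap.ext fun z => by
      obtain ⟨z, rfl⟩ := h.tensorInv_surjective h' z
      exact congrArg (h.tensorInv h') (h.tensorMap_tensorInv h' z))

theorem IsCoordinates.tensor (h : IsCoordinates X d P e) (h' : IsCoordinates Y d' R e') :
    IsCoordinates (Bimodule.tensor X Y) (d + d')
      (fun i => TensorProduct.map (P i) (R (i - d))) (h.tensorEquiv h') where
  left_ε j z := by
    obtain ⟨t, rfl⟩ := Submodule.mkQ_surjective _ z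
    have key : ∀ t, h.tensorMap h' ((Bimodule.balanced X Y).mkQ
        (LinearMap.rTensor Y.carrier (X.left (ε K n j)) t)) =
        cycLeftE (K := K) j (h.tensorMap h' ((Bimodule.balanced X Y).mkQ t)) := by
      intro t
      induction t with
      | zero => simp
      | add x y hx hy => simp only [map_add, hx, hy]
      | tmul x y =>
        rw [LinearMap.rTensor_tmul, tensorMap_mk, tensorMap_mk, h.left_ε, cycTensor_leftE]
    exact key t
  left_α j z := by
    obtain ⟨t, rfl⟩ := Submodule.mkQ_surjective _ z
    have key : ∀ t, h.tensorMap h' ((Bimodule.balanced X Y).mkQ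
        (LinearMap.rTensor Y.carrier (X.left (α K n j)) t)) =
        cycLeftA (K := K) j (h.tensorMap h' ((Bimodule.balanced X Y).mkQ t)) := by
      intro t
      induction t with
      | zero => simp
      | add x y hx hy => simp only [map_add, hx, hy]
      | tmul x y =>
        rw [LinearMap.rTensor_tmul, tensorMap_mk, tensorMap_mk, h.left_α, cycTensor_leftA]
    exact key t
  right_ε j z := by
    obtain ⟨t, rfl⟩ := Submodule.mkQ_surjective _ z
    have key : ∀ t, h.tensorMap h' ((Bimodule.balanced X Y).mkQ
        (LinearMap.lTensor X.carrier (Y.right (MulOpposite.op (ε K n j))) t)) =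
        cycRightE (K := K) (j + (d + d')) (h.tensorMap h' ((Bimodule.balanced X Y).mkQ t)) := by
      intro t
      induction t with
      | zero => simp
      | add x y hx hy => simp only [map_add, hx, hy]
      | tmul x y =>
        rw [LinearMap.lTensor_tmul, tensorMap_mk, tensorMap_mk, h'.right_ε, cycTensor_rightE]
    exact key t
  right_α j z := by
    obtain ⟨t, rfl⟩ := Submodule.mkQ_surjective _ z
    have key : ∀ t, h.tensorMap h' ((Bimodule.balanced X Y).mkQ
        (LinearMap.lTensor X.carrier (Y.right (MulOpposite.op (α K n j))) t)) =
        cycRightA (fun i => TensorProduct.map (P i) (R (i - d))) (j + (d + d'))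
          (h.tensorMap h' ((Bimodule.balanced X Y).mkQ t)) := by
      intro t
      induction t with
      | zero => simp
      | add x y hx hy => simp only [map_add, hx, hy]
      | tmul x y =>
        rw [LinearMap.lTensor_tmul, tensorMap_mk, tensorMap_mk, h'.right_α, cycTensor_rightA]
    exact key t

end Tensor

/-! ### Moving the holonomy to a single arrow -/

section Straighten

/-- The cycle is cut between `1` and `2`: `(i - 2).val` is the position of `i` in the list `2, 3, …,
n, 1`, and passing to `i + 1` wraps around only at `i = 1`. -/
theorem zmod_sub_two_val_add_one {n : ℕ} [NeZero n] {i : ZMod n} (hi : i ≠ 1) :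
    (i + 1 - 2).val = (i - 2).val + 1 := by
  have h : i + 1 - 2 = (i - 2) + 1 := by ring
  have hne : (i - 2).val + 1 ≠ n := by
    intro hv
    apply hi
    have h0 : ((i - 2).val + 1 : ℕ) = (0 : ZMod n) := by rw [hv]; simp
    push_cast at h0
    rw [ZMod.natCast_zmod_val] at h0
    linear_combination h0
  have hlt : (i - 2).val + 1 < n := by
    have := ZMod.val_lt (i - 2)
    omega
  have hcast : i + 1 - 2 = (((i - 2).val + 1 : ℕ) : ZMod n) := by
    push_cast
    rw [ZMod.natCast_zmod_val, h]
  rw [hcast, ZMod.val_natCast, Nat.mod_eq_of_lt hlt]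

theorem zmod_neg_one_val_eq {n : ℕ} [NeZero n] : (-1 : ZMod n).val = n - 1 := by
  obtain ⟨k, rfl⟩ : ∃ k, n = k + 1 := ⟨n - 1, by have := NeZero.pos n; omega⟩
  exact ZMod.val_neg_one k

/-- The holonomy of a tensor product of cyclic representations, with commuting automorphisms `A` at
`1` and `B` at `d + 1`, can be moved to the vertex `1`. -/
theorem exists_straighten {K : Type*} [Field K] {n : ℕ} [NeZero n] {V V' : Type*} [AddCommGroup V]
    [Module K V] [AddCommGroup V'] [Module K V'] (A B : Module.End K V) (B' : V ≃ₗ[K] V)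
    (hB' : B'.toLinearMap = B) (J : Module.End K V') (g : V ≃ₗ[K] V')
    (hg : ∀ v, g (B (A v)) = J (g v)) (d : ZMod n) :
    ∃ f : ZMod n → V ≃ₗ[K] V', ∀ i v,
      f i ((if i - d = 1 then B else 1) ((if i = 1 then A else 1) v)) =
        (if i = 1 then J else 1) (f (i + 1) v) := by
  -- Starting with `g` at `2`, the identification must change by `B'` on crossing the arrow `d + 1`,
  -- whose position is `(d - 1).val`. Closing up at the arrow `1` then requires exactly `g ∘ B ∘ A =
  -- J ∘ g`. If `d = 0`, both maps sit at the arrow `1` and `g` is used throughout.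
  refine ⟨fun i => if (i - 2).val ≤ (d - 1).val then g else B'.trans g, fun i v => ?_⟩
  have hB : ∀ v, B v = B' v := fun v => by rw [← hB']; rfl
  have hd := ZMod.val_lt (d - 1)
  by_cases hi : i = 1
  · subst hi
    have h1 : ((1 : ZMod n) - 2).val = n - 1 := by
      rw [← zmod_neg_one_val_eq]; congr 1; ring
    have h2 : ((1 : ZMod n) + 1 - 2).val = 0 := by
      rw [show (1 : ZMod n) + 1 - 2 = 0 by ring, ZMod.val_zero]
    have h3 : (1 - d = (1 : ZMod n)) ↔ n - 1 ≤ (d - 1).val := by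
      rw [sub_eq_self]
      constructor
      · rintro rfl
        rw [zero_sub, zmod_neg_one_val_eq]
      · intro h
        have : (d - 1).val = (-1 : ZMod n).val := by rw [zmod_neg_one_val_eq]; omega
        have := ZMod.val_injective n this
        linear_combination this
    simp only [h1, h2, h3, Nat.zero_le, if_true]
    split_ifs
    · exact hg v
    · simp [← hg, hB]
  · have h1 := zmod_sub_two_val_add_one hi
    have h2 : i - d = 1 ↔ (i - 2).val = (d - 1).val := by
      rw [(ZMod.val_injective n).eq_iff]
      constructor
      · intro h; linear_combination h
      · intro h; linear_combination h
    simp only [h1, h2, hi, if_false, Module.End.one_apply]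
    by_cases h : (i - 2).val = (d - 1).val
    · simp [h, hB]
    · by_cases h' : (i - 2).val ≤ (d - 1).val
      · simp [h, h', show (i - 2).val + 1 ≤ (d - 1).val by omega]
      · simp [h, h', show ¬ (i - 2).val + 1 ≤ (d - 1).val by omega]

end Straighten

theorem jordanCell_mulVec_injective {K : Type*} [Field K] (m : ℕ) (c : K) (hc : c ≠ 0) :
    Function.Injective (jordanCell K m c).mulVecLin := by
  have hdet : (jordanCell K m c).det = c ^ m := by
    rw [Matrix.det_of_isUpperTriangular]
    · simp [jordanCell]
    · intro i j hij
      have hij' : (j : ℕ) < i := hij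
      simp only [jordanCell, Matrix.of_apply]
      rw [if_neg (by rintro rfl; omega), if_neg (by omega)]
  exact Matrix.mulVec_injective_of_isUnit
    ((Matrix.isUnit_iff_isUnit_det _).2 (hdet ▸ (pow_ne_zero m hc).isUnit))

end BandBimod

end

/-! ### Tensor products of band bimodules -/

theorem proposition3p1 {K : Type*} [Field K] [IsAlgClosed K] [CharZero K]
    (n : ℕ) [NeZero n] (k₁ k₂ : ZMod n) (m₁ m₂ : ℕ) (hm₁ : 1 ≤ m₁) (hm₂ : 1 ≤ m₂)
    (c₁ c₂ : K) (hc₁ : c₁ ≠ 0) (hc₂ : c₂ ≠ 0) :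
    BandBimod.Bimodule.IsIso
      (BandBimod.Bimodule.tensor (BandBimod.band n k₁ m₁ c₁) (BandBimod.band n k₂ m₂ c₂))
      (BandBimod.Bimodule.directSum fun s : BandBimod.summandSizes m₁ m₂ =>
        BandBimod.band n (k₁ + k₂ - 1) s (c₁ * c₂)) := by
  open BandBimod in
  obtain ⟨g, hg⟩ := exists_equiv_jordanCell_tensor m₁ m₂ hm₁ hm₂ c₁ c₂ hc₁ hc₂
  let J₁ := (jordanCell K m₁ c₁).mulVecLin
  let J₂ := (jordanCell K m₂ c₂).mulVecLin
  let J₂' := LinearEquiv.ofInjectiveEndo J₂ (jordanCell_mulVec_injective m₂ c₂ hc₂)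
  obtain ⟨f, hf⟩ := exists_straighten (TensorProduct.map J₁ LinearMap.id)
    (TensorProduct.map LinearMap.id J₂) (TensorProduct.congr (LinearEquiv.refl K _) J₂')
    (TensorProduct.ext' fun v w => by simp [J₂'])
    (LinearMap.pi fun s : summandSizes m₁ m₂ =>
      (jordanCell K s (c₁ * c₂)).mulVecLin ∘ₗ LinearMap.proj s) g
    (fun v => by
      rw [← LinearMap.comp_apply (TensorProduct.map _ _), ← TensorProduct.map_comp]
      exact funext fun s => hg v s) (k₁ - 1)
  have h₁ := isCoordinates_band (K := K) k₁ m₁ c₁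
  have h₂ := isCoordinates_band (K := K) k₂ m₂ c₂
  have h₃ := IsCoordinates.directSum fun s : summandSizes m₁ m₂ =>
    isCoordinates_band (K := K) (k₁ + k₂ - 1) (s : ℕ) (c₁ * c₂)
  -- `B(k, m, c)` has twist `k - 1`, so adding twists yields the index `k₁ + k₂ - 1`.
  have hd : k₁ - 1 + (k₂ - 1) = k₁ + k₂ - 1 - 1 := by ring
  have h := h₁.tensor h₂
  rw [hd] at h
  refine h.isIso h₃ f fun i v => ?_
  -- The tensor of the two holonomies splits into a factor at `i = 1` and a factor at `i - (k₁ - 1)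
  -- = 1`, the form required for collecting them at `1`.
  have hl : TensorProduct.map (holonomy m₁ c₁ i) (holonomy m₂ c₂ (i - (k₁ - 1))) v =
      (if i - (k₁ - 1) = 1 then TensorProduct.map LinearMap.id J₂ else 1)
        ((if i = 1 then TensorProduct.map J₁ LinearMap.id else 1) v) := by
    induction v with
    | zero => simp
    | add x y hx hy => simp only [map_add, hx, hy]
    | tmul x y => unfold holonomy; split_ifs <;> simp [J₁, J₂]
  rw [hl, hf]
  funext s
  unfold holonomy
  split_ifs <;> rfl
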